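/- Let $\mathcal N$ be a finite set of players. For each $i\in\mathcal N$ let $\mathbb H_i$ be the real Euclidean space of $M_i\times M_i$ complex Hermitian matrices with inner product $\operatorname{tr}(XY)$, let $A_i>0$, and let $$\mathcal X_i=\{X_i\in\mathbb H_i : X_i\succcurlyeq 0,\ \|X_i\|\le A_i\},\qquad \mathcal X=\prod_{i}\mathcal X_i,$$ where $\|X_i\|$ is the nuclear norm (the sum of the absolute values of the eigenvalues). Player $i$ chooses $X_i\in\mathcal X_i$ to maximize a payoff $u_i(X)=u_i(X_i;X_{-i})$, $X\in\mathcal X$. Assume that each $u_i$ is concave and differentiable in $X_i\in\mathcal X_i$ and that its individual gradient $V_i(X)=\nabla_{X_i}u_i(X)$ is continuously differentiable on $\mathcal X$ (at boundary points, derivatives are taken relative to $\mathcal X$). The Hessian of the game is the block operator $D(X)=(D_{ij}(X))_{i,j}$ on $\prod_i\mathbb H_i$ with blocks $$D_{ij}(X)=\tfrac12\nabla_{X_i}\nabla_{X_j}u_j(X)+\tfrac12\big[\nabla_{X_j}\nabla_{X_i}u_i(X)\big]^\dagger .$$ A profile $X^*\in\mathcal X$ is a Nash equilibrium if $u_i(X^*)\ge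 u_i(X_i;X^*_{-i})$ for all $i$ and all $X_i\in\mathcal X_i$. Matrix exponential learning (MXL) starts from arbitrary Hermitian matrices $Y_i(0)$ and iterates, for $n=0,1,2,\dots$, $$X_i(n)=A_i\,\frac{\exp(Y_i(n))}{1+\|\exp(Y_i(n))\|},\qquad Y_i(n+1)=Y_i(n)+\gamma_n\,\tfrac12\big(\hat V_i(n)+\hat V_i(n)^\dagger\big),\qquad \hat V_i(n)=V_i(X(n))+Z_i(n),$$ where the step sizes $\gamma_n>0$ satisfy $\sum_n\gamma_n^2<\infty$ and $\sum_n\gamma_n=\infty$, and where the random complex matrices $Z(n)=\operatorname{diag}(Z_i(n))_i$ satisfy, for all $n$, $$\mathbb E[Z(n)\mid X(n)]=0,\qquad \mathbb E\big[\|Z(n)\|_*^2\mid X(n)\big]\le\sigma_*^2$$ for some constant $\sigma_*>0$; here $\|\cdot\|_*$ is the largest singular value (for a Hermitian matrix, the largest absolute value of an eigenvalue). If $D(X)$ is negative definite for every $X\in\mathcal X$, then the game has a unique Nash equilibrium $X^*$, and for every such run of MXL, $X(n)\to X^*$ almost surely. -/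

import Mathlib

open Set Filter Topology MeasureTheory
open scoped Matrix ComplexOrder

noncomputable section

/-! ### The Euclidean space of Hermitian matrices -/

/-- The real vector space of `m × m` complex Hermitian matrices. -/
def Herm (m : ℕ) : Type := selfAdjoint (Matrix (Fin m) (Fin m) ℂ)

namespace Herm

variable {m : ℕ}

instance : AddCommGroup (Herm m) :=
  inferInstanceAs (AddCommGroup (selfAdjoint (Matrix (Fin m) (Fin m) ℂ)))

instance : Module ℝ (Herm m) :=
  inferInstanceAs (Module ℝ (selfAdjoint (Matrix (Fin m) (Fin m) ℂ)))

/-- The underlying complex matrix. -/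
def toMatrix (X : Herm m) : Matrix (Fin m) (Fin m) ℂ :=
  Subtype.val (p := fun A => A ∈ selfAdjoint (Matrix (Fin m) (Fin m) ℂ)) X

theorem isHermitian (X : Herm m) : X.toMatrix.IsHermitian :=
  Subtype.property (p := fun A => A ∈ selfAdjoint (Matrix (Fin m) (Fin m) ℂ)) X

/-- A Hermitian matrix as an element of `Herm m`. -/
def mk (A : Matrix (Fin m) (Fin m) ℂ) (hA : A.IsHermitian) : Herm m :=
  Subtype.mk (p := fun A => A ∈ selfAdjoint (Matrix (Fin m) (Fin m) ℂ)) A hA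

@[simp] theorem toMatrix_mk (A : Matrix (Fin m) (Fin m) ℂ) (hA : A.IsHermitian) :
    (mk A hA).toMatrix = A := rfl

@[simp] theorem toMatrix_add (X Y : Herm m) : (X + Y).toMatrix = X.toMatrix + Y.toMatrix := rfl

@[simp] theorem toMatrix_smul (r : ℝ) (X : Herm m) : (r • X).toMatrix = r • X.toMatrix := rfl

@[simp] theorem toMatrix_zero : (0 : Herm m).toMatrix = 0 := rfl

theorem toMatrix_injective : Function.Injective (toMatrix (m := m)) :=
  fun _ _ h => Subtype.ext h

/-- The trace inner product `⟪X, Y⟫ = tr (X Y)`, which is real for Hermitian `X`, `Y`. -/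
@[reducible] def innerCore : InnerProductSpace.Core ℝ (Herm m) where
  inner X Y := (X.toMatrix * Y.toMatrix).trace.re
  conj_inner_symm X Y := by
    change (Y.toMatrix * X.toMatrix).trace.re = (X.toMatrix * Y.toMatrix).trace.re
    rw [Matrix.trace_mul_comm]
  re_inner_nonneg X := by
    change 0 ≤ (X.toMatrix * X.toMatrix).trace.re
    have h := (Matrix.posSemidef_conjTranspose_mul_self X.toMatrix).trace_nonneg
    rw [X.isHermitian.eq] at h
    exact (Complex.le_def.1 h).1
  add_left X Y W := by
    change ((X + Y).toMatrix * W.toMatrix).trace.re = _ + _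
    rw [toMatrix_add, add_mul, Matrix.trace_add, Complex.add_re]
  smul_left X Y r := by
    change ((r • X).toMatrix * Y.toMatrix).trace.re = r * (X.toMatrix * Y.toMatrix).trace.re
    rw [toMatrix_smul, Matrix.smul_mul, Matrix.trace_smul, Complex.smul_re, smul_eq_mul]
  definite X h := by
    have h0 : (X.toMatrix * X.toMatrix).trace.re = 0 := h
    have h1 := (Matrix.posSemidef_conjTranspose_mul_self X.toMatrix).trace_nonneg
    rw [X.isHermitian.eq] at h1
    have h2 : (X.toMatrix * X.toMatrix).trace = 0 :=
      Complex.ext h0 (Complex.le_def.1 h1).2.symm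
    apply toMatrix_injective
    have h3 : (X.toMatrixᴴ * X.toMatrix).trace = 0 := by rw [X.isHermitian.eq]; exact h2
    simpa using Matrix.trace_conjTranspose_mul_self_eq_zero_iff.1 h3

instance : NormedAddCommGroup (Herm m) := innerCore.toNormedAddCommGroup

instance : InnerProductSpace ℝ (Herm m) := InnerProductSpace.ofCore innerCore.toCore

instance : FiniteDimensional ℝ (Herm m) :=
  inferInstanceAs (FiniteDimensional ℝ
    (selfAdjoint.submodule ℝ (Matrix (Fin m) (Fin m) ℂ)))

instance : CompleteSpace (Herm m) := FiniteDimensional.complete ℝ (Herm m)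

instance : MeasurableSpace (Herm m) := borel (Herm m)

instance : BorelSpace (Herm m) := ⟨rfl⟩

/-- The nuclear (trace) norm: the sum of the absolute values of the eigenvalues. -/
def nuclearNorm (X : Herm m) : ℝ := ∑ k, |X.isHermitian.eigenvalues k|

/-- The matrix exponential of a Hermitian matrix. -/
def exp (Y : Herm m) : Herm m := mk (NormedSpace.exp Y.toMatrix) Y.isHermitian.exp

/-- The Hermitian part `(A + Aᴴ) / 2` of a complex matrix. -/
def ofMatrix (A : Matrix (Fin m) (Fin m) ℂ) : Herm m :=
  mk ((1 / 2 : ℝ) • (A + A.conjTranspose)) (by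
    simp [Matrix.IsHermitian, add_comm])

/-- The exponential projection `Y ↦ a exp(Y) / (1 + ‖exp(Y)‖)`. -/
def expProj (a : ℝ) (Y : Herm m) : Herm m := (a / (1 + Y.exp.nuclearNorm)) • Y.exp

end Herm

/-- The singular norm (largest singular value) of a complex matrix, that is, its operator norm on
Euclidean space; for a Hermitian matrix it is the largest absolute value of an eigenvalue. -/
def singularNorm {m : ℕ} (A : Matrix (Fin m) (Fin m) ℂ) : ℝ :=
  ‖Matrix.toEuclideanCLM (n := Fin m) (𝕜 := ℂ) A‖

/-! ### Games with matrix variables -/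

/-- The data of a game with player set `ι`: player `i` controls an `M i × M i` Hermitian matrix,
has trace budget `A i > 0` and payoff function `u i`. -/
structure MatrixGame (ι : Type*) where
  M : ι → ℕ
  A : ι → ℝ
  A_pos : ∀ i, 0 < A i
  u : ι → (∀ j, Herm (M j)) → ℝ

namespace MatrixGame

variable {ι : Type*} (G : MatrixGame ι)

/-- Profiles of Hermitian matrices, one for each player. -/
abbrev Profile : Type _ := ∀ i, Herm (G.M i)

/-- The feasible actions of player `i`: `X ≽ 0` with nuclear norm at most `A i`. -/
def actions (i : ι) : Set (Herm (G.M i)) :=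
  {X | X.toMatrix.PosSemidef ∧ X.nuclearNorm ≤ G.A i}

/-- The feasible profiles. -/
def feasible : Set G.Profile := {X | ∀ i, X i ∈ G.actions i}

section

variable [DecidableEq ι]

/-- Nash equilibrium: no player gains by deviating unilaterally. -/
def IsNash (X : G.Profile) : Prop :=
  X ∈ G.feasible ∧ ∀ i, ∀ Y ∈ G.actions i, G.u i (Function.update X i Y) ≤ G.u i X

/-- Every payoff function is concave in the player's own action. -/
def IndividuallyConcave : Prop :=
  ∀ i, ∀ X ∈ G.feasible, ConcaveOn ℝ (G.actions i) fun Y => G.u i (Function.update X i Y)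

/-- The individual payoff gradient `V_i(X)` of player `i`: the gradient, for the trace inner
product, of `u_i(· ; X_{-i})` at `X_i`. At boundary points of the feasible set (a convex body)
derivatives are taken relative to that set. -/
def grad (i : ι) (X : G.Profile) : Herm (G.M i) :=
  gradientWithin (fun Y => G.u i (Function.update X i Y)) (G.actions i) (X i)

/-- The partial derivative `∇_{X_j} V_i(X) = ∇_{X_j} ∇_{X_i} u_i(X)`, as a linear map from
directions of player `j` to Hermitian matrices of player `i`. -/
def gradDeriv (i j : ι) (X : G.Profile) : Herm (G.M j) →L[ℝ] Herm (G.M i) :=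
  fderivWithin ℝ (fun Y => G.grad i (Function.update X j Y)) (G.actions j) (X j)

/-- The `(i, j)` block
`D_{ij} = (1/2) ∇_{X_i} ∇_{X_j} u_j + (1/2) [∇_{X_j} ∇_{X_i} u_i]†` of the Hessian of the game.
The rows of a mixed derivative `∇_{X_i} ∇_{X_j} u_j` are indexed by `X_i` and its columns by
`X_j`, so it acts from the `j`-th to the `i`-th space as the transpose of `∇_{X_i} V_j`. -/
def hessianBlock (i j : ι) (X : G.Profile) : Herm (G.M j) →L[ℝ] Herm (G.M i) :=
  (1 / 2 : ℝ) • ContinuousLinearMap.adjoint (G.gradDeriv j i X) +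
    (1 / 2 : ℝ) • G.gradDeriv i j X

variable [Fintype ι]

/-- The payoffs are smooth enough for the gradients and the Hessian to be defined classically:
`u_i` is differentiable in `X_i` and its individual gradient is continuously differentiable on the
feasible set. -/
def IndividuallySmooth : Prop :=
  (∀ i, ∀ X ∈ G.feasible, DifferentiableWithinAt ℝ
    (fun Y => G.u i (Function.update X i Y)) (G.actions i) (X i)) ∧
  ∀ i, ContDiffOn ℝ 1 (G.grad i) G.feasible

/-- The Hessian `D(X) = (D_{ij}(X))` of the game is negative definite. -/
def HessianNegDef (X : G.Profile) : Prop :=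
  ∀ H : G.Profile, H ≠ 0 → ∑ i, ∑ j, inner ℝ (H i) (G.hessianBlock i j X (H j)) < 0

end

/-! ### Matrix exponential learning -/

/-- Profiles of complex (not necessarily Hermitian) matrices. -/
abbrev MatrixProfile : Type _ := ∀ i, Matrix (Fin (G.M i)) (Fin (G.M i)) ℂ

/-- The profile of actions induced by a profile of scores. -/
def choice (Y : G.Profile) : G.Profile := fun i => Herm.expProj (G.A i) (Y i)

/-- The score matrices `Y(n)` of matrix exponential learning with step sizes `γ`, initial scores
`Y₀` and a realization `z` of the noise: the gradient estimate of player `i` at stage `n` is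
`V_i(X(n)) + z_i(n)`, replaced by its Hermitian part. -/
def score [DecidableEq ι] (γ : ℕ → ℝ) (Y₀ : G.Profile) (z : ℕ → G.MatrixProfile) :
    ℕ → G.Profile
  | 0 => Y₀
  | n + 1 => fun i => score γ Y₀ z n i +
      γ n • Herm.ofMatrix ((G.grad i (G.choice (score γ Y₀ z n))).toMatrix + z n i)

/-- The actions `X(n)` of matrix exponential learning. -/
def mxl [DecidableEq ι] (γ : ℕ → ℝ) (Y₀ : G.Profile) (z : ℕ → G.MatrixProfile) (n : ℕ) :
    G.Profile :=
  G.choice (G.score γ Y₀ z n)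

/-- The singular norm of the block-diagonal matrix `diag(Z_i)`. -/
def blockNorm (Z : G.MatrixProfile) : ℝ := ⨆ i, singularNorm (Z i)

/-- The noise process `Z` of matrix exponential learning consists of random matrices with zero mean
and mean square at most `σ²` conditionally on the current action profile `X(n)`. -/
structure IsAdmissibleNoise [DecidableEq ι] {Ω : Type*} [MeasurableSpace Ω] (μ : Measure Ω)
    (γ : ℕ → ℝ) (Y₀ : G.Profile) (Z : ℕ → Ω → G.MatrixProfile) (σ : ℝ) : Prop where
  measurable : ∀ n i a b, Measurable fun ω => Z n ω i a b
  integrable_sq : ∀ n, Integrable (fun ω => G.blockNorm (Z n ω) ^ 2) μ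
  zero_mean : ∀ n i a b,
    μ[fun ω => Z n ω i a b |
      MeasurableSpace.comap (fun ω => G.mxl γ Y₀ (fun k => Z k ω) n) inferInstance] =ᵐ[μ] 0
  mean_sq : ∀ n,
    μ[fun ω => G.blockNorm (Z n ω) ^ 2 |
      MeasurableSpace.comap (fun ω => G.mxl γ Y₀ (fun k => Z k ω) n) inferInstance]
      ≤ᵐ[μ] fun _ => σ ^ 2

end MatrixGame

end

/-! Write `V` for the profile of individual gradients. Symmetrization does not change a quadratic
form, so negative definiteness of the game's Hessian says that the derivative of `V` is negative
definite. Integrating along segments makes `V` strictly monotone (`gradForm_sub_lt`). By concavity,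
Nash equilibria are exactly the solutions of the variational inequality of `V`. A solution exists by
Minty's argument (`exists_variational_solution`), and strict monotonicity makes it unique and
strictly variationally stable.

For the dynamics, `log (1 + tr exp Y)` is a convex potential whose gradient is the unit-budget
choice map, and this gradient is Lipschitz. Both facts reduce to scalar inequalities between
eigenvalues (`inner_spec_spec`). The Fenchel coupling `energy` with the equilibrium is therefore
nonnegative, and in one step it changes by at most a drift, negative away from equilibrium, plus a
linear noise term, plus an error of order `(γ (1 + ‖z‖))²` (`exists_step_bound`).

The noise is centered given `X(n)` only, not given the whole past, so its partial sums need not form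
a martingale. Only expectations are used. The noise term pairs `Z(n)` with a function of `X(n)`,
hence has mean zero, and telescoping gives `∑ γ_n P(dist (X(n)) X* ≥ δ) < ∞` (`summable_measure`).
The expected total length of the steps taken outside the `δ`-ball is then finite too, so almost
surely that length is finite for every `δ`. Since the steps tend to zero and `∑ γ_n = ∞`, the
process returns to every ball, and its late excursions are too short to go far
(`tendsto_of_summable_indicator`). -/

namespace Herm

variable {m : ℕ}

/-! ### Spectral calculus for a pair of Hermitian matrices. -/

@[simp] theorem toMatrix_sub (X Y : Herm m) : (X - Y).toMatrix = X.toMatrix - Y.toMatrix := rfl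

@[simp] theorem toMatrix_neg (X : Herm m) : (-X).toMatrix = -X.toMatrix := rfl

theorem inner_def (X Y : Herm m) : inner ℝ X Y = (X.toMatrix * Y.toMatrix).trace.re := rfl

/-- The identity matrix. -/
noncomputable def one (m : ℕ) : Herm m := mk 1 Matrix.isHermitian_one

@[simp] theorem toMatrix_one : (one m).toMatrix = 1 := rfl

theorem inner_one_left (X : Herm m) : inner ℝ (one m) X = X.toMatrix.trace.re := by
  simp [inner_def]

/-- The real functional calculus `f(X) = U diag(f(λ)) U*` in the eigenbasis of `X`. -/
noncomputable def spec (X : Herm m) (f : ℝ → ℝ) : Herm m :=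
  mk ((X.isHermitian.eigenvectorUnitary : Matrix (Fin m) (Fin m) ℂ) *
    Matrix.diagonal (fun k => (f (X.isHermitian.eigenvalues k) : ℂ)) *
    (X.isHermitian.eigenvectorUnitary : Matrix (Fin m) (Fin m) ℂ)ᴴ) (by
      apply Matrix.isHermitian_mul_mul_conjTranspose
      simp [Matrix.IsHermitian, Matrix.diagonal_conjTranspose, Pi.star_def])

theorem spec_id (X : Herm m) : X.spec id = X := by
  apply toMatrix_injective
  have h := X.isHermitian.spectral_theorem
  rw [Unitary.conjStarAlgAut_apply] at h
  exact h.symm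

theorem eigenvectorUnitary_mul_conjTranspose (X : Herm m) :
    (X.isHermitian.eigenvectorUnitary : Matrix (Fin m) (Fin m) ℂ) *
      (X.isHermitian.eigenvectorUnitary : Matrix (Fin m) (Fin m) ℂ)ᴴ = 1 :=
  Unitary.coe_mul_star_self _

theorem conjTranspose_mul_eigenvectorUnitary (X : Herm m) :
    (X.isHermitian.eigenvectorUnitary : Matrix (Fin m) (Fin m) ℂ)ᴴ *
      (X.isHermitian.eigenvectorUnitary : Matrix (Fin m) (Fin m) ℂ) = 1 :=
  Unitary.coe_star_mul_self _

theorem spec_one (X : Herm m) : X.spec (fun _ => 1) = one m := by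
  apply toMatrix_injective
  simp [spec, eigenvectorUnitary_mul_conjTranspose]

theorem spec_exp (X : Herm m) : X.spec Real.exp = X.exp := by
  apply toMatrix_injective
  have h := X.isHermitian.spectral_theorem
  rw [Unitary.conjStarAlgAut_apply] at h
  have hU := X.conjTranspose_mul_eigenvectorUnitary
  have hinv := Matrix.inv_eq_left_inv hU
  change _ = NormedSpace.exp X.toMatrix
  conv_rhs => rw [h]
  rw [Matrix.star_eq_conjTranspose, ← hinv, Matrix.exp_conj _ _ (IsUnit.of_mul_eq_one_right _ hU),
    Matrix.exp_diagonal]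
  simp only [spec, toMatrix_mk, hinv]
  congr 3
  funext k
  simp [Pi.coe_exp, ← Complex.exp_eq_exp_ℂ]

/-- The squared modulus of the inner product of the eigenvectors of `X` and `Y`. -/
noncomputable def overlap (X Y : Herm m) (i j : Fin m) : ℝ :=
  Complex.normSq (((X.isHermitian.eigenvectorUnitary : Matrix (Fin m) (Fin m) ℂ)ᴴ *
    (Y.isHermitian.eigenvectorUnitary : Matrix (Fin m) (Fin m) ℂ)) i j)

theorem overlap_nonneg (X Y : Herm m) (i j : Fin m) : 0 ≤ X.overlap Y i j :=
  Complex.normSq_nonneg _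

/-- The nonnegative weights do not depend on `f` and `g`. An inequality valid for every pair of
eigenvalues therefore passes to traces, although the two matrices need not commute. -/
theorem inner_spec_spec (X Y : Herm m) (f g : ℝ → ℝ) :
    inner ℝ (X.spec f) (Y.spec g) = ∑ i, ∑ j, X.overlap Y i j *
      (f (X.isHermitian.eigenvalues i) * g (Y.isHermitian.eigenvalues j)) := by
  rw [inner_def]
  simp only [spec, toMatrix_mk, overlap]
  generalize (X.isHermitian.eigenvectorUnitary : Matrix (Fin m) (Fin m) ℂ) = U
  generalize (Y.isHermitian.eigenvectorUnitary : Matrix (Fin m) (Fin m) ℂ) = V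
  generalize X.isHermitian.eigenvalues = a
  generalize Y.isHermitian.eigenvalues = b
  have h1 : (U * Matrix.diagonal (fun k => (f (a k) : ℂ)) * Uᴴ *
      (V * Matrix.diagonal (fun k => (g (b k) : ℂ)) * Vᴴ)).trace =
      ((Matrix.diagonal (fun k => (f (a k) : ℂ)) * (Uᴴ * V)) *
        (Matrix.diagonal (fun k => (g (b k) : ℂ)) * (Uᴴ * V)ᴴ)).trace := by
    rw [Matrix.conjTranspose_mul, Matrix.conjTranspose_conjTranspose, Matrix.mul_assoc,
      Matrix.mul_assoc U, Matrix.trace_mul_comm U]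
    simp only [Matrix.mul_assoc]
  rw [h1]
  generalize Uᴴ * V = W
  simp only [Matrix.trace, Matrix.diag, Matrix.mul_apply (M := _ * W), Matrix.diagonal_mul,
    Matrix.conjTranspose_apply, Complex.re_sum]
  refine Finset.sum_congr rfl fun i _ => Finset.sum_congr rfl fun j _ => ?_
  have : (f (a i) : ℂ) * W i j * ((g (b j) : ℂ) * star (W i j)) =
      ((Complex.normSq (W i j) * (f (a i) * g (b j)) : ℝ) : ℂ) := by
    push_cast
    rw [← Complex.mul_conj]
    simp only [RCLike.star_def]
    ring
  rw [this, Complex.ofReal_re]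

theorem inner_spec_self (X : Herm m) (f g : ℝ → ℝ) :
    inner ℝ (X.spec f) (X.spec g) =
      ∑ i, f (X.isHermitian.eigenvalues i) * g (X.isHermitian.eigenvalues i) := by
  rw [inner_spec_spec]
  simp [overlap, conjTranspose_mul_eigenvectorUnitary, Matrix.one_apply, apply_ite]

theorem trace_spec (X : Herm m) (f : ℝ → ℝ) :
    (X.spec f).toMatrix.trace.re = ∑ i, f (X.isHermitian.eigenvalues i) := by
  rw [← inner_one_left, ← spec_one X, inner_spec_self]
  simp

/-- Summed form of the fact that the overlaps are doubly stochastic, read off from `inner_spec_spec`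
with one function equal to 1. It lets a single trace enter the double sum. -/
theorem sum_overlap_right (X Y : Herm m) (g : ℝ → ℝ) :
    ∑ i, ∑ j, X.overlap Y i j * g (Y.isHermitian.eigenvalues j) =
      ∑ j, g (Y.isHermitian.eigenvalues j) := by
  have h := inner_spec_spec X Y (fun _ => 1) g
  rw [spec_one, inner_one_left, trace_spec] at h
  simpa using h.symm

theorem sum_overlap_left (X Y : Herm m) (f : ℝ → ℝ) :
    ∑ i, ∑ j, X.overlap Y i j * f (X.isHermitian.eigenvalues i) =
      ∑ i, f (X.isHermitian.eigenvalues i) := by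
  have h := inner_spec_spec X Y f (fun _ => 1)
  rw [spec_one, real_inner_comm, inner_one_left, trace_spec] at h
  simpa using h.symm

theorem norm_spec_sub_spec_sq (X Y : Herm m) (f : ℝ → ℝ) :
    ‖X.spec f - Y.spec f‖ ^ 2 = ∑ i, ∑ j, X.overlap Y i j *
      (f (X.isHermitian.eigenvalues i) - f (Y.isHermitian.eigenvalues j)) ^ 2 := by
  rw [norm_sub_sq_real, ← real_inner_self_eq_norm_sq, ← real_inner_self_eq_norm_sq,
    inner_spec_self, inner_spec_self, inner_spec_spec,
    ← sum_overlap_left X Y (fun x => f x * f x), ← sum_overlap_right X Y (fun x => f x * f x),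
    Finset.mul_sum, ← Finset.sum_sub_distrib, ← Finset.sum_add_distrib]
  refine Finset.sum_congr rfl fun i _ => ?_
  rw [Finset.mul_sum, ← Finset.sum_sub_distrib, ← Finset.sum_add_distrib]
  exact Finset.sum_congr rfl fun j _ => by ring

/-- Klein's inequality for the exponential. -/
theorem inner_exp_sub_le (X Y : Herm m) :
    inner ℝ Y.exp (X - Y) ≤ X.exp.toMatrix.trace.re - Y.exp.toMatrix.trace.re := by
  have h1 : inner ℝ Y.exp X = ∑ i, ∑ j, X.overlap Y i j *
      (X.isHermitian.eigenvalues i * Real.exp (Y.isHermitian.eigenvalues j)) := by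
    conv_lhs => rw [real_inner_comm, ← spec_exp, ← spec_id X, inner_spec_spec]
    rfl
  have h2 : inner ℝ Y.exp Y = ∑ i, ∑ j, X.overlap Y i j *
      (Real.exp (Y.isHermitian.eigenvalues j) * Y.isHermitian.eigenvalues j) := by
    have h := inner_spec_self Y Real.exp id
    rw [spec_exp, spec_id] at h
    rw [h, sum_overlap_right X Y (fun x => Real.exp x * x)]
    rfl
  rw [inner_sub_right, h1, h2, ← spec_exp, ← spec_exp, trace_spec, trace_spec,
    ← sum_overlap_left X Y, ← sum_overlap_right X Y]
  simp only [← Finset.sum_sub_distrib]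
  refine Finset.sum_le_sum fun i _ => Finset.sum_le_sum fun j _ => ?_
  rw [← mul_sub, ← mul_sub]
  refine mul_le_mul_of_nonneg_left ?_ (X.overlap_nonneg Y i j)
  generalize X.isHermitian.eigenvalues i = a
  generalize Y.isHermitian.eigenvalues j = b
  -- The scalar case: the graph of `exp` lies above its tangent at `b`.
  have h := mul_le_mul_of_nonneg_left (Real.add_one_le_exp (a - b)) (Real.exp_pos b).le
  rw [← Real.exp_add, add_sub_cancel] at h
  linarith

theorem spec_posSemidef (X : Herm m) {f : ℝ → ℝ} (hf : ∀ x, 0 ≤ f x) :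
    (X.spec f).toMatrix.PosSemidef := by
  refine Matrix.PosSemidef.mul_mul_conjTranspose_same ?_ _
  exact Matrix.PosSemidef.diagonal fun k => by
    simpa using hf _

theorem exp_posSemidef (X : Herm m) : X.exp.toMatrix.PosSemidef := by
  rw [← spec_exp]
  exact X.spec_posSemidef fun x => (Real.exp_pos x).le

theorem nuclearNorm_of_posSemidef {X : Herm m} (hX : X.toMatrix.PosSemidef) :
    X.nuclearNorm = X.toMatrix.trace.re := by
  have h := X.trace_spec id
  rw [spec_id] at h
  rw [h, nuclearNorm]
  exact Finset.sum_congr rfl fun k _ => abs_of_nonneg (hX.eigenvalues_nonneg k)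

/-! ### The log-trace potential and its Lipschitz gradient. -/

theorem trace_exp_nonneg (Y : Herm m) : 0 ≤ Y.exp.toMatrix.trace.re := by
  rw [← nuclearNorm_of_posSemidef Y.exp_posSemidef]
  exact Finset.sum_nonneg fun _ _ => abs_nonneg _

/-- The potential `log (1 + tr exp Y)` of the exponential projection. -/
noncomputable def logPart (Y : Herm m) : ℝ := Real.log (1 + Y.exp.toMatrix.trace.re)

theorem exp_logPart (Y : Herm m) : Real.exp Y.logPart = 1 + Y.exp.toMatrix.trace.re :=
  Real.exp_log (by linarith [Y.trace_exp_nonneg])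

theorem logPart_nonneg (Y : Herm m) : 0 ≤ Y.logPart :=
  Real.log_nonneg (by linarith [Y.trace_exp_nonneg])

theorem exp_sub_smul_one (Y : Herm m) (c : ℝ) :
    (Y - c • one m).exp = Real.exp (-c) • Y.exp := by
  apply toMatrix_injective
  change NormedSpace.exp (Y.toMatrix - c • (1 : Matrix (Fin m) (Fin m) ℂ)) =
    Real.exp (-c) • NormedSpace.exp Y.toMatrix
  have h1 : (-c) • (1 : Matrix (Fin m) (Fin m) ℂ) = Matrix.diagonal fun _ => ((-c : ℝ) : ℂ) := by
    ext i j
    by_cases h : i = j <;> simp [h]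
  rw [sub_eq_add_neg, ← neg_smul, Matrix.exp_add_of_commute _ _
    ((Commute.one_right _).smul_right _), h1, Matrix.exp_diagonal]
  ext i j
  simp [Pi.coe_exp, ← Complex.exp_eq_exp_ℂ, mul_comm]

/-- The score shifted so that its exponential is the choice for unit budget. -/
noncomputable def shift (Y : Herm m) : Herm m := Y - Y.logPart • one m

theorem expProj_eq (a : ℝ) (Y : Herm m) : expProj a Y = a • Y.shift.exp := by
  rw [shift, exp_sub_smul_one, Real.exp_neg, exp_logPart, expProj,
    nuclearNorm_of_posSemidef Y.exp_posSemidef, smul_smul, div_eq_mul_inv]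

/-- The unused budget `exp (-logPart)` acts as one further eigenvalue with score zero; it completes
the trace to 1. -/
theorem trace_exp_shift (Y : Herm m) :
    Y.shift.exp.toMatrix.trace.re = 1 - Real.exp (-Y.logPart) := by
  have h := Y.exp_logPart
  rw [shift, exp_sub_smul_one, toMatrix_smul, Matrix.trace_smul, Complex.smul_re, smul_eq_mul,
    show Y.exp.toMatrix.trace.re = Real.exp Y.logPart - 1 by linarith, mul_sub, ← Real.exp_add]
  simp

theorem eigenvalues_shift_nonpos (Y : Herm m) (k : Fin m) :
    Y.shift.isHermitian.eigenvalues k ≤ 0 := by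
  have h := Y.trace_exp_shift
  rw [← spec_exp, trace_spec] at h
  have h1 := Finset.single_le_sum (f := fun i => Real.exp (Y.shift.isHermitian.eigenvalues i))
    (fun i _ => (Real.exp_pos _).le) (Finset.mem_univ k)
  rw [← Real.exp_le_one_iff]
  have := Real.exp_pos (-Y.logPart)
  linarith

theorem abs_exp_sub_exp_le {a b : ℝ} (ha : a ≤ 0) (hb : b ≤ 0) :
    |Real.exp a - Real.exp b| ≤ |a - b| := by
  wlog hab : b ≤ a generalizing a b
  · rw [abs_sub_comm, abs_sub_comm a]
    exact this hb ha (le_of_not_ge hab)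
  rw [abs_of_nonneg (sub_nonneg.2 (Real.exp_le_exp.2 hab)), abs_of_nonneg (sub_nonneg.2 hab)]
  have h := mul_le_mul_of_nonneg_left (Real.add_one_le_exp (b - a)) (Real.exp_pos a).le
  rw [← Real.exp_add, add_sub_cancel] at h
  have h2 : Real.exp a ≤ 1 := Real.exp_le_one_iff.2 ha
  nlinarith

/-- On the nonpositive half-line `exp` is 1-Lipschitz. For the norm of the trace inner product,
`norm_spec_sub_spec_sq` transfers this to matrices with the same constant. -/
theorem norm_exp_sub_exp_le {X Y : Herm m} (hX : ∀ k, X.isHermitian.eigenvalues k ≤ 0)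
    (hY : ∀ k, Y.isHermitian.eigenvalues k ≤ 0) : ‖X.exp - Y.exp‖ ≤ ‖X - Y‖ := by
  rw [← abs_of_nonneg (norm_nonneg (X.exp - Y.exp)), ← abs_of_nonneg (norm_nonneg (X - Y)),
    ← sq_le_sq, ← spec_exp, ← spec_exp, norm_spec_sub_spec_sq]
  conv_rhs => rw [← spec_id X, ← spec_id Y, norm_spec_sub_spec_sq]
  exact Finset.sum_le_sum fun i _ => Finset.sum_le_sum fun j _ =>
    mul_le_mul_of_nonneg_left (sq_le_sq.2 (abs_exp_sub_exp_le (hX i) (hY j)))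
      (X.overlap_nonneg Y i j)

/-- The potential is convex with gradient `exp (shift Y)`. -/
theorem inner_exp_shift_le (X Y : Herm m) :
    inner ℝ Y.shift.exp (X - Y) ≤ X.logPart - Y.logPart := by
  have h := inner_exp_sub_le X.shift Y.shift
  have h1 : inner ℝ Y.shift.exp (X.shift - Y.shift) = inner ℝ Y.shift.exp (X - Y) -
      (X.logPart - Y.logPart) * (1 - Real.exp (-Y.logPart)) := by
    rw [← trace_exp_shift, ← inner_one_left, real_inner_comm _ (one m), ← inner_smul_right,
      ← inner_sub_right]
    congr 1
    simp only [shift]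
    module
  rw [h1, trace_exp_shift, trace_exp_shift] at h
  -- Klein's inequality leaves a defect from the unused budget; the tangent inequality for that
  -- extra scalar coordinate absorbs it.
  have h2 := mul_le_mul_of_nonneg_left (Real.add_one_le_exp (Y.logPart - X.logPart))
    (Real.exp_pos (-Y.logPart)).le
  rw [← Real.exp_add, show -Y.logPart + (Y.logPart - X.logPart) = -X.logPart by ring] at h2
  linarith

theorem norm_exp_shift_le (Y : Herm m) : ‖Y.shift.exp‖ ≤ 1 := by
  rw [← abs_of_nonneg (norm_nonneg _), ← sq_le_one_iff_abs_le_one, ← real_inner_self_eq_norm_sq]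
  have h := Y.trace_exp_shift
  rw [← spec_exp, trace_spec] at h
  rw [← spec_exp, inner_spec_self]
  calc _ ≤ ∑ i, Real.exp (Y.shift.isHermitian.eigenvalues i) :=
        Finset.sum_le_sum fun i _ => mul_le_of_le_one_left (Real.exp_pos _).le
          (Real.exp_le_one_iff.2 (Y.eigenvalues_shift_nonpos i))
    _ ≤ 1 := by linarith [Real.exp_pos (-Y.logPart)]

theorem abs_logPart_sub_le (X Y : Herm m) : |X.logPart - Y.logPart| ≤ ‖X - Y‖ := by
  have h : ∀ X Y : Herm m, X.logPart - Y.logPart ≤ ‖X - Y‖ := fun X Y => by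
    have h1 := inner_exp_shift_le Y X
    have h2 := real_inner_le_norm X.shift.exp (X - Y)
    rw [← neg_sub X Y, inner_neg_right] at h1
    have h3 := mul_le_of_le_one_left (norm_nonneg (X - Y)) X.norm_exp_shift_le
    linarith
  rw [abs_le]
  constructor
  · have := h Y X
    rw [norm_sub_rev] at this
    linarith
  · exact h X Y

/-- Both shifted scores are negative semidefinite, where `exp` is nonexpansive. The factor comes
from the shift, whose scalar part is 1-Lipschitz. -/
theorem norm_exp_shift_sub_le (X Y : Herm m) :
    ‖X.shift.exp - Y.shift.exp‖ ≤ (1 + ‖one m‖) * ‖X - Y‖ := by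
  refine (norm_exp_sub_exp_le X.eigenvalues_shift_nonpos Y.eigenvalues_shift_nonpos).trans ?_
  have h : X.shift - Y.shift = (X - Y) - (X.logPart - Y.logPart) • one m := by
    simp only [shift]
    module
  rw [h]
  refine (norm_sub_le _ _).trans ?_
  rw [norm_smul, Real.norm_eq_abs, add_mul, one_mul, mul_comm ‖one m‖]
  gcongr
  exact abs_logPart_sub_le X Y

/-- The gradient inequality at `X` bounds the increment using the gradient there; replacing it by
the gradient at `Y` costs the Lipschitz constant times the squared distance. No integration is
needed, at the price of the usual factor 1/2. -/
theorem logPart_le (X Y : Herm m) : X.logPart ≤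
    Y.logPart + inner ℝ Y.shift.exp (X - Y) + (1 + ‖one m‖) * ‖X - Y‖ ^ 2 := by
  have h1 := inner_exp_shift_le Y X
  rw [← neg_sub X Y, inner_neg_right] at h1
  have h2 := real_inner_le_norm (X.shift.exp - Y.shift.exp) (X - Y)
  rw [inner_sub_left] at h2
  have h3 := mul_le_mul_of_nonneg_right (norm_exp_shift_sub_le X Y) (norm_nonneg (X - Y))
  nlinarith

/-- The potential dominates the linear functionals given by the feasible actions. -/
theorem inner_le_mul_logPart {X : Herm m} {a : ℝ} (hX : X.toMatrix.PosSemidef)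
    (ha : X.nuclearNorm ≤ a) (Y : Herm m) : inner ℝ Y X ≤ a * Y.logPart := by
  have h1 : inner ℝ Y.shift X ≤ 0 := by
    rw [← spec_id X, ← spec_id Y.shift, inner_spec_spec]
    exact Finset.sum_nonpos fun i _ => Finset.sum_nonpos fun j _ =>
      mul_nonpos_of_nonneg_of_nonpos (overlap_nonneg _ _ i j)
        (mul_nonpos_of_nonpos_of_nonneg (eigenvalues_shift_nonpos _ i) (hX.eigenvalues_nonneg j))
  rw [shift, inner_sub_left, inner_smul_left, inner_one_left,
    ← nuclearNorm_of_posSemidef hX] at h1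
  have h2 := mul_le_mul_of_nonneg_left ha Y.logPart_nonneg
  simp only [conj_trivial] at h1
  linarith

/-! ### Geometry of the feasible sets. -/

/-- `toMatrix` as a linear map. -/
def toMatrixLinear (m : ℕ) : Herm m →ₗ[ℝ] Matrix (Fin m) (Fin m) ℂ where
  toFun := toMatrix
  map_add' _ _ := rfl
  map_smul' _ _ := rfl

theorem continuous_toMatrix : Continuous (toMatrix (m := m)) :=
  (toMatrixLinear m).continuous_of_finiteDimensional

theorem isClosed_posSemidef : IsClosed {X : Herm m | X.toMatrix.PosSemidef} := by
  have h : {X : Herm m | X.toMatrix.PosSemidef} =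
      ⋂ x : Fin m → ℂ, {X : Herm m | 0 ≤ star x ⬝ᵥ X.toMatrix *ᵥ x} := by
    ext X
    simp [Matrix.posSemidef_iff_dotProduct_mulVec, X.isHermitian]
  rw [h]
  refine isClosed_iInter fun x => isClosed_le continuous_const ?_
  exact continuous_const.dotProduct (continuous_toMatrix.matrix_mulVec continuous_const)

/-- The feasible actions for the trace budget `a`. -/
def budgetSet (m : ℕ) (a : ℝ) : Set (Herm m) := {X | X.toMatrix.PosSemidef ∧ X.nuclearNorm ≤ a}

/-- On the positive semidefinite cone the nuclear norm is the trace, so the budget becomes a linear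
constraint. -/
theorem budgetSet_eq (m : ℕ) (a : ℝ) :
    budgetSet m a = {X | X.toMatrix.PosSemidef} ∩ {X | inner ℝ (one m) X ≤ a} := by
  ext X
  refine and_congr_right fun h => ?_
  rw [nuclearNorm_of_posSemidef h, mem_ofPred_eq, inner_one_left]

theorem isClosed_budgetSet (a : ℝ) : IsClosed (budgetSet m a) := by
  rw [budgetSet_eq]
  exact isClosed_posSemidef.inter (isClosed_le (by fun_prop) continuous_const)

theorem convex_budgetSet (a : ℝ) : Convex ℝ (budgetSet m a) := by
  rw [budgetSet_eq]
  refine Convex.inter ?_ ?_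
  · intro X hX Y hY s t hs ht _
    exact (Matrix.PosSemidef.smul hX hs).add (Matrix.PosSemidef.smul hY ht)
  · exact convex_halfSpace_le (innerₛₗ ℝ (one m)).isLinear a

theorem norm_sq_eq_sum (X : Herm m) : ‖X‖ ^ 2 = ∑ i, X.isHermitian.eigenvalues i ^ 2 := by
  have h := inner_spec_self X id id
  rw [spec_id, real_inner_self_eq_norm_sq] at h
  simpa [sq] using h

theorem abs_eigenvalues_le_norm (X : Herm m) (k : Fin m) : |X.isHermitian.eigenvalues k| ≤ ‖X‖ := by
  rw [← abs_of_nonneg (norm_nonneg X), ← sq_le_sq, norm_sq_eq_sum]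
  exact Finset.single_le_sum (f := fun i => X.isHermitian.eigenvalues i ^ 2)
    (fun i _ => sq_nonneg _) (Finset.mem_univ k)

theorem norm_le_of_mem_budgetSet {a : ℝ} {X : Herm m} (hX : X ∈ budgetSet m a) : ‖X‖ ≤ a := by
  have h0 : 0 ≤ X.nuclearNorm := Finset.sum_nonneg fun _ _ => abs_nonneg _
  refine le_trans ?_ hX.2
  rw [← abs_of_nonneg (norm_nonneg X), ← abs_of_nonneg h0, ← sq_le_sq, norm_sq_eq_sum, nuclearNorm]
  simp_rw [← sq_abs (X.isHermitian.eigenvalues _)]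
  exact Finset.sum_sq_le_sq_sum_of_nonneg fun _ _ => abs_nonneg _

theorem isCompact_budgetSet (a : ℝ) : IsCompact (budgetSet m a) := by
  have := FiniteDimensional.proper ℝ (Herm m)
  refine Metric.isCompact_of_isClosed_isBounded (isClosed_budgetSet a) ?_
  exact isBounded_iff_forall_norm_le.2 ⟨a, fun _ => norm_le_of_mem_budgetSet⟩

theorem zero_mem_budgetSet {a : ℝ} (ha : 0 ≤ a) : (0 : Herm m) ∈ budgetSet m a := by
  rw [budgetSet_eq]
  exact ⟨Matrix.PosSemidef.zero, by simpa using ha⟩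

theorem smul_one_add_posSemidef {X : Herm m} {c : ℝ} (hX : ‖X‖ ≤ c) :
    (c • one m + X).toMatrix.PosSemidef := by
  have h : c • one m + X = X.spec (fun x => c + x) := by
    conv_lhs => rw [← spec_id X, ← spec_one X]
    apply toMatrix_injective
    simp only [spec, toMatrix_add, toMatrix_smul, toMatrix_mk]
    rw [← Matrix.smul_mul, ← Matrix.mul_smul, ← Matrix.add_mul, ← Matrix.mul_add]
    congr 2
    ext i j
    by_cases hij : i = j <;> simp [hij]
  rw [h]
  refine Matrix.PosSemidef.mul_mul_conjTranspose_same ?_ _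
  refine Matrix.PosSemidef.diagonal fun k => ?_
  have := neg_le_of_abs_le ((abs_eigenvalues_le_norm X k).trans hX)
  simp only [Pi.zero_apply, Complex.zero_le_real]
  linarith

theorem interior_budgetSet_nonempty {a : ℝ} (ha : 0 < a) : (interior (budgetSet m a)).Nonempty := by
  set b : ℝ := ‖one m‖ ^ 2 with hb
  -- The ball of radius `c` around `c • 1` stays in the cone, and its traces are at most `c (‖1‖² +
  -- ‖1‖) < a`. The extra 1 keeps the denominator positive for matrices of size zero.
  set c : ℝ := a / (b + ‖one m‖ + 1) with hc
  have hpos : 0 < b + ‖one m‖ + 1 := by positivity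
  have hcpos : 0 < c := div_pos ha hpos
  refine ⟨c • one m, mem_interior_iff_mem_nhds.2 (Filter.mem_of_superset
    (Metric.ball_mem_nhds _ hcpos) fun X hX => ?_)⟩
  rw [mem_ball_iff_norm] at hX
  rw [budgetSet_eq]
  obtain ⟨W, rfl⟩ : ∃ W, X = c • one m + W := ⟨X - c • one m, by abel⟩
  rw [add_sub_cancel_left] at hX
  refine ⟨smul_one_add_posSemidef hX.le, ?_⟩
  rw [mem_ofPred_eq, inner_add_right, inner_smul_right, real_inner_self_eq_norm_sq]
  have h1 := real_inner_le_norm (one m) W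
  have h2 : c * (b + ‖one m‖ + 1) = a := div_mul_cancel₀ _ hpos.ne'
  have h3 := mul_le_mul_of_nonneg_left hX.le (norm_nonneg (one m))
  rw [← hb]
  nlinarith

theorem uniqueDiffOn_budgetSet {a : ℝ} (ha : 0 < a) : UniqueDiffOn ℝ (budgetSet m a) :=
  uniqueDiffOn_convex (convex_budgetSet a) (interior_budgetSet_nonempty ha)

theorem expProj_mem_budgetSet {a : ℝ} (ha : 0 ≤ a) (Y : Herm m) : expProj a Y ∈ budgetSet m a := by
  rw [budgetSet_eq, expProj_eq]
  refine ⟨Matrix.PosSemidef.smul (exp_posSemidef _) ha, ?_⟩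
  rw [mem_ofPred_eq, inner_smul_right, inner_one_left, trace_exp_shift]
  exact mul_le_of_le_one_right ha (by linarith [Real.exp_pos (-Y.logPart)])

theorem norm_expProj_sub_le {a : ℝ} (ha : 0 ≤ a) (X Y : Herm m) :
    ‖expProj a X - expProj a Y‖ ≤ a * (1 + ‖one m‖) * ‖X - Y‖ := by
  rw [expProj_eq, expProj_eq, ← smul_sub, norm_smul, Real.norm_of_nonneg ha, mul_assoc]
  exact mul_le_mul_of_nonneg_left (norm_exp_shift_sub_le X Y) ha

theorem continuous_expProj {a : ℝ} (ha : 0 ≤ a) : Continuous (expProj (m := m) a) := by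
  refine (LipschitzWith.of_dist_le_mul (K := (a * (1 + ‖one m‖)).toNNReal) fun X Y => ?_).continuous
  rw [dist_eq_norm, dist_eq_norm, Real.coe_toNNReal _ (by positivity)]
  exact norm_expProj_sub_le ha X Y

/-! ### Hermitian parts of the noise matrices. -/

theorem toMatrix_ofMatrix (z : Matrix (Fin m) (Fin m) ℂ) :
    (ofMatrix z).toMatrix = (1 / 2 : ℝ) • (z + zᴴ) := rfl

theorem ofMatrix_toMatrix_add (V : Herm m) (z : Matrix (Fin m) (Fin m) ℂ) :
    ofMatrix (V.toMatrix + z) = V + ofMatrix z := by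
  apply toMatrix_injective
  rw [toMatrix_add, toMatrix_ofMatrix, toMatrix_ofMatrix, Matrix.conjTranspose_add,
    V.isHermitian.eq, add_add_add_comm, smul_add, ← two_smul ℝ V.toMatrix, smul_smul]
  norm_num

/-- A Hermitian `X` has the same real pairing with `z` and with `zᴴ`. The entrywise form matches the
entrywise zero-mean condition on the noise. -/
theorem inner_ofMatrix (X : Herm m) (z : Matrix (Fin m) (Fin m) ℂ) :
    inner ℝ X (ofMatrix z) = (∑ a, ∑ b, X.toMatrix a b * z b a).re := by
  have h : (X.toMatrix * zᴴ).trace.re = (X.toMatrix * z).trace.re := by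
    have h1 : (X.toMatrix * zᴴ).trace = star (X.toMatrix * z).trace := by
      rw [← Matrix.trace_conjTranspose, Matrix.conjTranspose_mul, X.isHermitian.eq,
        Matrix.trace_mul_comm]
    rw [h1]
    simp
  have h2 : (X.toMatrix * z).trace = ∑ a, ∑ b, X.toMatrix a b * z b a := by
    simp [Matrix.trace, Matrix.mul_apply]
  rw [inner_def, ← h2, toMatrix_ofMatrix, Matrix.mul_smul, Matrix.mul_add, Matrix.trace_smul,
    Matrix.trace_add, Complex.smul_re, Complex.add_re, h, smul_eq_mul]
  ring

theorem norm_apply_le_singularNorm (z : Matrix (Fin m) (Fin m) ℂ) (a b : Fin m) :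
    ‖z a b‖ ≤ singularNorm z := by
  have h1 := (Matrix.toEuclideanCLM (n := Fin m) (𝕜 := ℂ) z).le_opNorm
    (EuclideanSpace.single b 1)
  have h2 := PiLp.norm_apply_le
    (Matrix.toEuclideanCLM (n := Fin m) (𝕜 := ℂ) z (EuclideanSpace.single b 1)) a
  have h3 : (Matrix.toEuclideanCLM (n := Fin m) (𝕜 := ℂ) z (EuclideanSpace.single b 1)) a =
      z a b := by
    simp [Matrix.ofLp_toEuclideanCLM]
  rw [h3] at h2
  simpa [singularNorm] using h2.trans h1

theorem singularNorm_nonneg (z : Matrix (Fin m) (Fin m) ℂ) : 0 ≤ singularNorm z := norm_nonneg _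

theorem norm_sq_eq_sum_apply (X : Herm m) : ‖X‖ ^ 2 = ∑ a, ∑ b, ‖X.toMatrix a b‖ ^ 2 := by
  rw [← real_inner_self_eq_norm_sq, inner_def]
  simp only [Matrix.trace, Matrix.diag, Matrix.mul_apply, Complex.re_sum]
  refine Finset.sum_congr rfl fun a _ => Finset.sum_congr rfl fun b _ => ?_
  rw [← X.isHermitian.apply b a, Complex.star_def, Complex.mul_conj, Complex.ofReal_re,
    Complex.normSq_eq_norm_sq]

theorem norm_ofMatrix_le (z : Matrix (Fin m) (Fin m) ℂ) :
    ‖ofMatrix z‖ ≤ m * singularNorm z := by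
  have hs := singularNorm_nonneg z
  have h0 : 0 ≤ m * singularNorm z := by positivity
  rw [← abs_of_nonneg (norm_nonneg (ofMatrix z)), ← abs_of_nonneg h0, ← sq_le_sq,
    norm_sq_eq_sum_apply]
  have h : ∀ a b, ‖(ofMatrix z).toMatrix a b‖ ^ 2 ≤ singularNorm z ^ 2 := fun a b => by
    refine pow_le_pow_left₀ (norm_nonneg _) ?_ 2
    rw [toMatrix_ofMatrix, Matrix.smul_apply, Matrix.add_apply, Matrix.conjTranspose_apply,
      norm_smul]
    have h1 := norm_add_le (z a b) (star (z b a))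
    rw [norm_star] at h1
    have h2 := norm_apply_le_singularNorm z a b
    have h3 := norm_apply_le_singularNorm z b a
    rw [Real.norm_of_nonneg (by norm_num)]
    linarith
  calc _ ≤ ∑ _a : Fin m, ∑ _b : Fin m, singularNorm z ^ 2 :=
        Finset.sum_le_sum fun a _ => Finset.sum_le_sum fun b _ => h a b
    _ = (m * singularNorm z) ^ 2 := by
        simp
        ring

end Herm

/-! ### General tools: variational inequalities, a convergence criterion, concave functions. -/

/-- Minty's theorem: a monotone variational inequality on a compact convex set has a solution. -/
theorem exists_variational_solution {E : Type*} [AddCommGroup E] [Module ℝ E] [TopologicalSpace E]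
    [IsTopologicalAddGroup E] [ContinuousSMul ℝ E] {K : Set E} (hK : IsCompact K)
    (hconv : Convex ℝ K) (hne : K.Nonempty) (V : E → E →L[ℝ] ℝ)
    (hV : ∀ h, ContinuousOn (fun x => V x h) K)
    (hmono : ∀ x ∈ K, ∀ y ∈ K, V y (y - x) ≤ V x (y - x)) :
    ∃ x ∈ K, ∀ y ∈ K, V x (y - x) ≤ 0 := by
  classical
  have hminty : ∃ x ∈ K, ∀ y ∈ K, V y (y - x) ≤ 0 := by
    -- Minty's form of the inequality is a closed condition on `x`, so compactness reduces it to
    -- finitely many test points.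
    have hfin : ∀ s : Finset K, (K ∩ ⋂ y ∈ s, {x | V y (y - x) ≤ 0}).Nonempty := by
      intro s
      rcases s.eq_empty_or_nonempty with rfl | hs
      · simpa using hne
      have : Nonempty s := hs.to_subtype
      -- A zero-sum game in which the opponent mixes the test points with weights `q`. It is affine
      -- in each variable, so Sion's theorem provides a saddle point.
      let f : E → (s → ℝ) → ℝ := fun x q => ∑ k : s, q k * V k.1 (k.1 - x)
      have hfl : ∀ q : s → ℝ, ∀ x y : E, ∀ a b : ℝ, a + b = 1 →
          f (a • x + b • y) q = a * f x q + b * f y q := by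
        intro q x y a b hab
        simp only [f, Finset.mul_sum, ← Finset.sum_add_distrib]
        refine Finset.sum_congr rfl fun k _ => ?_
        have : (k.1 : E) - (a • x + b • y) = a • ((k.1 : E) - x) + b • ((k.1 : E) - y) := by
          rw [eq_sub_of_add_eq' hab]
          module
        rw [this, map_add, map_smul, map_smul, smul_eq_mul, smul_eq_mul]
        ring
      have hfr : ∀ x : E, ∀ p q : s → ℝ, ∀ a b : ℝ, f x (a • p + b • q) = a * f x p + b * f x q := by
        intro x p q a b
        simp only [f, Finset.mul_sum, ← Finset.sum_add_distrib, Pi.add_apply, Pi.smul_apply,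
          smul_eq_mul]
        exact Finset.sum_congr rfl fun k _ => by ring
      have hcl : ∀ q, Continuous fun x => f x q := fun q => by
        simp only [f]
        fun_prop
      have hcr : ∀ x, Continuous fun q => f x q := fun x => by
        simp only [f]
        fun_prop
      obtain ⟨a, ha, b, hb, hab⟩ := Sion.exists_isSaddlePointOn (f := f) (X := K)
        (Y := stdSimplex ℝ s) hne hconv hK
        (fun q _ => (hcl q).lowerSemicontinuous.lowerSemicontinuousOn _)
        (fun q _ => ConvexOn.quasiconvexOn ⟨hconv, fun x _ y _ a b _ _ hab =>
          (hfl q x y a b hab).le⟩)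
        (convex_stdSimplex ℝ s) ⟨_, single_mem_stdSimplex ℝ (Classical.arbitrary s)⟩
        (isCompact_stdSimplex ℝ s)
        (fun x _ => (hcr x).upperSemicontinuous.upperSemicontinuousOn _)
        (fun x _ => ConcaveOn.quasiconcaveOn ⟨convex_stdSimplex ℝ s, fun p _ q _ a b _ _ _ =>
          (hfr x p q a b).ge⟩)
      refine ⟨a, ha, ?_⟩
      simp only [mem_iInter, mem_ofPred_eq]
      intro y hy
      -- Compare the saddle point with the barycenter of the optimal weights on one side and a pure
      -- test point on the other.
      have h1 := hab (∑ k : s, b k • (k.1 : E))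
        (hconv.sum_mem (fun k _ => hb.1 k) hb.2 (fun k _ => k.1.2))
        (Pi.single ⟨y, hy⟩ 1) (single_mem_stdSimplex ℝ _)
      have h2 : f a (Pi.single ⟨y, hy⟩ 1) = V y (y - a) := by
        simp only [f]
        rw [Finset.sum_eq_single ⟨y, hy⟩]
        · simp
        · intro k _ hk
          simp [Pi.single_eq_of_ne hk]
        · simp
      rw [h2] at h1
      refine h1.trans ?_
      have h3 : f (∑ k : s, b k • (k.1 : E)) b =
          ∑ k : s, ∑ l : s, b k * b l * V k.1 ((k.1 : E) - l.1) := by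
        simp only [f]
        refine Finset.sum_congr rfl fun k _ => ?_
        have : (k.1 : E) - ∑ l : s, b l • (l.1 : E) = ∑ l : s, b l • ((k.1 : E) - l.1) := by
          simp_rw [smul_sub]
          rw [Finset.sum_sub_distrib, ← Finset.sum_smul, hb.2, one_smul]
        rw [this, map_sum, Finset.mul_sum]
        exact Finset.sum_congr rfl fun l _ => by rw [map_smul, smul_eq_mul, mul_assoc]
      -- Adding the double sum to its transpose pairs the terms `(k, l)` and `(l, k)`, whose sum has
      -- a sign by monotonicity.
      have h4 : f (∑ k : s, b k • (k.1 : E)) b + f (∑ k : s, b k • (k.1 : E)) b ≤ 0 := by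
        conv_lhs => rw [h3]
        conv_lhs => enter [2]; rw [Finset.sum_comm]
        simp only [← Finset.sum_add_distrib]
        refine Finset.sum_nonpos fun k _ => Finset.sum_nonpos fun l _ => ?_
        have h5 := hmono l.1 l.1.2 k.1 k.1.2
        rw [← neg_sub (k.1 : E) (l.1 : E), map_neg]
        have h6 := mul_nonneg (hb.1 k) (hb.1 l)
        nlinarith
      linarith
    have := hK.inter_iInter_nonempty (fun y : K => {x | V y (y - x) ≤ 0})
      (fun y => isClosed_le (by fun_prop) continuous_const) hfin
    obtain ⟨x, hx, hx'⟩ := this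
    exact ⟨x, hx, fun y hy => by simpa using mem_iInter.1 hx' ⟨y, hy⟩⟩
  obtain ⟨x, hx, h⟩ := hminty
  refine ⟨x, hx, fun y hy => ?_⟩
  -- Minty's trick: test with a point of the segment from `x` to `y`, divide by `t`, and let `t`
  -- decrease to 0.
  have hmem : ∀ t ∈ Icc (0 : ℝ) 1, x + t • (y - x) ∈ K := fun t ht =>
    hconv.add_smul_sub_mem hx hy ht
  have hc : ContinuousOn (fun t : ℝ => V (x + t • (y - x)) (y - x)) (Icc 0 1) :=
    (hV (y - x)).comp (by fun_prop) hmem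
  have hlim := (hc 0 (by simp)).mono (Ioc_subset_Icc_self)
  simp only [ContinuousWithinAt, zero_smul, add_zero] at hlim
  have : (𝓝[Ioc (0 : ℝ) 1] 0).NeBot := by
    rw [nhdsWithin_Ioc_eq_nhdsGT zero_lt_one]
    infer_instance
  refine le_of_tendsto hlim ?_
  filter_upwards [self_mem_nhdsWithin] with t ht
  have := h _ (hmem t (Ioc_subset_Icc_self ht))
  rw [add_sub_cancel_left, map_smul, smul_eq_mul] at this
  exact nonpos_of_mul_nonpos_right this ht.1

/-- A sequence converges to `p` if its steps tend to zero and, outside each ball around `p`, both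
the total length of its steps and the total weight `γ` of its stages are finite. -/
theorem tendsto_of_summable_indicator {E : Type*} [PseudoMetricSpace E] {x : ℕ → E} {p : E}
    {γ l : ℕ → ℝ} (hγs : ¬ Summable γ) (hl : ∀ n, dist (x n) (x (n + 1)) ≤ l n)
    (hl0 : Tendsto l atTop (𝓝 0))
    (hγi : ∀ δ > 0, Summable ({n | δ ≤ dist (x n) p}.indicator γ))
    (hli : ∀ δ > 0, Summable ({n | δ ≤ dist (x n) p}.indicator l)) :
    Tendsto x atTop (𝓝 p) := by
  rw [Metric.tendsto_atTop]
  intro ε hε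
  set δ := ε / 3 with hδ
  have hδpos : 0 < δ := by positivity
  set a := {n | δ ≤ dist (x n) p}.indicator l with ha
  obtain ⟨N₁, hN₁⟩ := (Metric.tendsto_atTop.1 hl0) δ hδpos
  obtain ⟨N₂, hN₂⟩ : ∃ N, ∀ m n, N ≤ m → m ≤ n → ∑ k ∈ Finset.Ico m n, a k < δ := by
    obtain ⟨N, hN⟩ := Metric.cauchySeq_iff.1 ((hli δ hδpos).hasSum.tendsto_sum_nat.cauchySeq)
      δ hδpos
    refine ⟨N, fun m n hm hmn => ?_⟩
    have := hN n (hm.trans hmn) m hm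
    rw [Real.dist_eq, ← Finset.sum_Ico_eq_sub _ hmn] at this
    exact (le_abs_self _).trans_lt this
  -- If the sequence never came back to the `δ`-ball, the indicator would be eventually trivial and
  -- `γ` summable.
  obtain ⟨N, hN, hNp⟩ : ∃ N ≥ max N₁ N₂, dist (x N) p < δ := by
    by_contra! hcon
    refine hγs ?_
    rw [← summable_nat_add_iff (max N₁ N₂)]
    refine ((summable_nat_add_iff (max N₁ N₂)).2 (hγi δ hδpos)).congr fun n => ?_
    exact indicator_of_mem (s := {n | δ ≤ dist (x n) p}) (hcon _ (Nat.le_add_left _ _)) γ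
  -- Here `m` is the start of the current excursion: one step of length below `δ` from the `δ`-ball
  -- gives `2 * δ`. The rest of the excursion adds less than `δ`, whence `ε / 3`.
  have key : ∀ n, N ≤ n → ∃ m, N ≤ m ∧ m ≤ n ∧
      dist (x n) p ≤ 2 * δ + ∑ k ∈ Finset.Ico m n, a k := by
    intro n hn
    induction n, hn using Nat.le_induction with
    | base => exact ⟨N, le_rfl, le_rfl, by simp; linarith⟩
    | succ n hn ih =>
      have htri := dist_triangle_left (x (n + 1)) p (x n)
      have hln := hl n
      rcases lt_or_ge (dist (x n) p) δ with h | h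
      · refine ⟨n + 1, by omega, le_rfl, ?_⟩
        have h1 := hN₁ n (by omega)
        rw [Real.dist_eq, sub_zero] at h1
        have := le_abs_self (l n)
        simp only [Finset.Ico_self, Finset.sum_empty]
        linarith
      · obtain ⟨m, hm, hmn, hd⟩ := ih
        refine ⟨m, hm, by omega, ?_⟩
        rw [Finset.sum_Ico_succ_top hmn]
        have : a n = l n := indicator_of_mem (show n ∈ {n | δ ≤ dist (x n) p} from h) l
        linarith
  refine ⟨N, fun n hn => ?_⟩
  obtain ⟨m, hm, hmn, hd⟩ := key n hn
  have := hN₂ m n (by omega) hmn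
  linarith

theorem ConcaveOn.sub_le_of_hasFDerivWithinAt {E : Type*} [NormedAddCommGroup E] [NormedSpace ℝ E]
    {f : E → ℝ} {f' : E →L[ℝ] ℝ} {s : Set E} (hf : ConcaveOn ℝ s f) {x y : E} (hx : x ∈ s)
    (hy : y ∈ s) (hf' : HasFDerivWithinAt f f' s x) : f y - f x ≤ f' (y - x) := by
  have hmem : ∀ t ∈ Icc (0 : ℝ) 1, x + t • (y - x) ∈ s := fun t ht =>
    hf.1.add_smul_sub_mem hx hy ht
  have hline : HasDerivWithinAt (fun t : ℝ => x + t • (y - x)) (y - x) (Icc 0 1) 0 := by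
    simpa using (((hasDerivAt_id (0 : ℝ)).smul_const (y - x)).const_add x).hasDerivWithinAt
  have hd : HasDerivWithinAt (fun t : ℝ => f (x + t • (y - x))) (f' (y - x)) (Icc 0 1) 0 :=
    HasFDerivWithinAt.comp_hasDerivWithinAt (t := s) (0 : ℝ) (by simpa using hf') hline hmem
  have hc : ConcaveOn ℝ (Icc (0 : ℝ) 1) (fun t : ℝ => f (x + t • (y - x))) := by
    refine ⟨convex_Icc 0 1, fun t ht r hr a b ha hb hab => ?_⟩
    have := hf.2 (hmem t ht) (hmem r hr) ha hb hab
    refine this.trans (le_of_eq ?_)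
    congr 1
    rw [eq_sub_of_add_eq' hab]
    simp only [smul_eq_mul]
    module
  have := hc.slope_le_of_hasDerivWithinAt (by simp) (by simp) zero_lt_one hd
  simpa [slope_def_field] using this

/-! ### Monotonicity of the gradient field; existence, uniqueness and stability of the equilibrium.
-/

namespace MatrixGame

variable {ι : Type*} (G : MatrixGame ι)

theorem actions_eq (i : ι) : G.actions i = Herm.budgetSet (G.M i) (G.A i) := rfl

theorem feasible_eq : G.feasible = univ.pi fun i => Herm.budgetSet (G.M i) (G.A i) := by
  ext X
  simp [feasible, actions_eq]

theorem convex_feasible : Convex ℝ G.feasible := by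
  rw [feasible_eq]
  exact convex_pi fun i _ => Herm.convex_budgetSet _

theorem isCompact_feasible : IsCompact G.feasible := by
  rw [feasible_eq]
  exact isCompact_univ_pi fun i => Herm.isCompact_budgetSet _

theorem zero_mem_feasible : (0 : G.Profile) ∈ G.feasible := fun i =>
  Herm.zero_mem_budgetSet (G.A_pos i).le

theorem update_mem_feasible [DecidableEq ι] {X : G.Profile} (hX : X ∈ G.feasible) {i : ι} {Y : Herm (G.M i)}
    (hY : Y ∈ G.actions i) : Function.update X i Y ∈ G.feasible := by
  intro j
  rcases eq_or_ne j i with rfl | h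
  · simpa using hY
  · simpa [Function.update_of_ne h] using hX j

theorem choice_mem_feasible (Y : G.Profile) : G.choice Y ∈ G.feasible := fun i =>
  Herm.expProj_mem_budgetSet (G.A_pos i).le _

theorem continuous_choice : Continuous G.choice :=
  continuous_pi fun i => (Herm.continuous_expProj (G.A_pos i).le).comp (continuous_apply i)

variable [Fintype ι] [DecidableEq ι]

variable {G}

theorem hasFDerivWithinAt_payoff (hsmooth : G.IndividuallySmooth) {X : G.Profile}
    (hX : X ∈ G.feasible) (i : ι) :
    HasFDerivWithinAt (fun Y => G.u i (Function.update X i Y)) (innerSL ℝ (G.grad i X))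
      (G.actions i) (X i) :=
  (hsmooth.1 i X hX).hasGradientWithinAt.hasFDerivWithinAt

theorem isNash_of_inner_nonpos (hconc : G.IndividuallyConcave) (hsmooth : G.IndividuallySmooth)
    {X : G.Profile} (hX : X ∈ G.feasible)
    (h : ∀ i, ∀ Y ∈ G.actions i, inner ℝ (G.grad i X) (Y - X i) ≤ 0) : G.IsNash X := by
  refine ⟨hX, fun i Y hY => ?_⟩
  have h1 := (hconc i X hX).sub_le_of_hasFDerivWithinAt (hX i) hY
    (hasFDerivWithinAt_payoff hsmooth hX i)
  have h2 := h i Y hY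
  simp only [Function.update_eq_self, innerSL_apply_apply] at h1
  linarith

theorem IsNash.inner_nonpos (hsmooth : G.IndividuallySmooth) {X : G.Profile} (hX : G.IsNash X)
    (i : ι) {Y : Herm (G.M i)} (hY : Y ∈ G.actions i) :
    inner ℝ (G.grad i X) (Y - X i) ≤ 0 := by
  have hmax : IsMaxOn (fun Y => G.u i (Function.update X i Y)) (G.actions i) (X i) :=
    fun Y hY => by simpa using hX.2 i Y hY
  exact hmax.localize.hasFDerivWithinAt_nonpos (hasFDerivWithinAt_payoff hsmooth hX.1 i)
    (sub_mem_posTangentConeAt_of_segment_subset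
      ((Herm.convex_budgetSet (G.A i)).segment_subset (hX.1 i) hY))

variable (G) in
/-- The pairing `H ↦ ∑ i, ⟪V_i(X), H_i⟫` with the gradient profile at `X`. -/
noncomputable def gradForm (X : G.Profile) : G.Profile →L[ℝ] ℝ :=
  ∑ i, (innerSL ℝ (G.grad i X)).comp (ContinuousLinearMap.proj i)

theorem gradForm_apply (X H : G.Profile) : G.gradForm X H = ∑ i, inner ℝ (G.grad i X) (H i) := by
  simp [gradForm]

theorem continuousOn_gradForm (hsmooth : G.IndividuallySmooth) (H : G.Profile) :
    ContinuousOn (fun X => G.gradForm X H) G.feasible := by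
  simp only [gradForm_apply]
  exact continuousOn_finsetSum _ fun i _ =>
    ((hsmooth.2 i).continuousOn).inner continuousOn_const

/-- Chain rule along `Function.update`. The action sets are convex with nonempty interior, so
relative derivatives are unique, also at boundary points. -/
theorem gradDeriv_eq (hsmooth : G.IndividuallySmooth) {X : G.Profile} (hX : X ∈ G.feasible)
    (i j : ι) : G.gradDeriv i j X = (fderivWithin ℝ (G.grad i) G.feasible X).comp
      (ContinuousLinearMap.single ℝ (fun i => Herm (G.M i)) j) := by
  have h1 : HasFDerivWithinAt (G.grad i) (fderivWithin ℝ (G.grad i) G.feasible X) G.feasible X :=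
    (((hsmooth.2 i).differentiableOn one_ne_zero) X hX).hasFDerivWithinAt
  have h2 := (hasFDerivAt_update (𝕜 := ℝ) X (X j)).hasFDerivWithinAt (s := G.actions j)
  have h3 := HasFDerivWithinAt.comp (X j) (t := G.feasible) (g := G.grad i)
    (g' := fderivWithin ℝ (G.grad i) G.feasible X) (by simpa using h1) h2
    (fun Y hY => G.update_mem_feasible hX hY)
  have h4 := h3.fderivWithin (Herm.uniqueDiffOn_budgetSet (G.A_pos j) _ (hX j))
  refine Eq.trans h4 ?_
  congr 1
  ext H k
  rcases eq_or_ne k j with rfl | hk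
  · simp
  · simp [Pi.single_eq_of_ne hk]

/-- Moving the adjoint across the inner product turns one half of the Hessian form into the other
with indices exchanged. The double sum is thus the quadratic form of the derivative of the gradient
profile. -/
theorem inner_fderivWithin_neg (hsmooth : G.IndividuallySmooth)
    {X : G.Profile} (hX : X ∈ G.feasible) (hD : G.HessianNegDef X) {H : G.Profile} (hH : H ≠ 0) :
    ∑ i, inner ℝ (fderivWithin ℝ (G.grad i) G.feasible X H) (H i) < 0 := by
  have h := hD H hH
  have h1 : ∀ i, inner ℝ (fderivWithin ℝ (G.grad i) G.feasible X H) (H i) =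
      ∑ j, inner ℝ (H i) (G.gradDeriv i j X (H j)) := by
    intro i
    have : H = ∑ j, ContinuousLinearMap.single ℝ (fun i => Herm (G.M i)) j (H j) := by
      simp [Finset.univ_sum_single]
    conv_lhs => enter [2]; rw [this]
    rw [map_sum, real_inner_comm, inner_sum]
    simp only [gradDeriv_eq hsmooth hX, ContinuousLinearMap.comp_apply]
  have h2 : ∀ i j, inner ℝ (H i) (G.hessianBlock i j X (H j)) =
      1 / 2 * inner ℝ (H j) (G.gradDeriv j i X (H i)) +
      1 / 2 * inner ℝ (H i) (G.gradDeriv i j X (H j)) := by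
    intro i j
    rw [hessianBlock, add_apply, smul_apply,
      smul_apply, inner_add_right, inner_smul_right, inner_smul_right,
      ContinuousLinearMap.adjoint_inner_right, real_inner_comm]
  simp only [h2, Finset.sum_add_distrib, ← Finset.mul_sum] at h
  rw [Finset.sum_comm] at h
  simp only [h1]
  linarith

/-- Strict monotonicity: along the segment from `X` to `Y`, the pairing with `Y - X` has negative
derivative. -/
theorem gradForm_sub_lt (hsmooth : G.IndividuallySmooth)
    (hD : ∀ X ∈ G.feasible, G.HessianNegDef X) {X Y : G.Profile} (hX : X ∈ G.feasible)
    (hY : Y ∈ G.feasible) (hne : X ≠ Y) :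
    G.gradForm Y (Y - X) < G.gradForm X (Y - X) := by
  have hmem : ∀ t ∈ Icc (0 : ℝ) 1, X + t • (Y - X) ∈ G.feasible := fun t ht =>
    G.convex_feasible.add_smul_sub_mem hX hY ht
  have hline : ∀ t : ℝ, HasDerivWithinAt (fun t : ℝ => X + t • (Y - X)) (Y - X) (Icc 0 1) t :=
    fun t => by
      simpa using (((hasDerivAt_id t).smul_const (Y - X)).const_add X).hasDerivWithinAt
  have hd : ∀ t ∈ Icc (0 : ℝ) 1, HasDerivWithinAt (fun t : ℝ => G.gradForm (X + t • (Y - X)) (Y - X))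
      (∑ i, inner ℝ (fderivWithin ℝ (G.grad i) G.feasible (X + t • (Y - X)) (Y - X)) ((Y - X) i))
      (Icc 0 1) t := by
    intro t ht
    simp only [gradForm_apply]
    refine HasDerivWithinAt.fun_sum fun i _ => ?_
    have h1 := (((hsmooth.2 i).differentiableOn one_ne_zero) _ (hmem t ht)).hasFDerivWithinAt
    have h2 := (h1.comp_hasDerivWithinAt t (hline t) hmem).inner ℝ
      (hasDerivWithinAt_const t (Icc 0 1) ((Y - X) i))
    simpa using h2
  have hanti : StrictAntiOn (fun t : ℝ => G.gradForm (X + t • (Y - X)) (Y - X)) (Icc 0 1) := by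
    refine strictAntiOn_of_deriv_neg (convex_Icc 0 1) (fun t ht => (hd t ht).continuousWithinAt) ?_
    intro t ht
    rw [interior_Icc] at ht
    have ht' := Ioo_subset_Icc_self ht
    rw [((hd t ht').hasDerivAt (Icc_mem_nhds ht.1 ht.2)).deriv]
    exact inner_fderivWithin_neg hsmooth (hmem t ht') (hD _ (hmem t ht')) (sub_ne_zero.2 hne.symm)
  simpa using hanti (by simp) (by simp) zero_lt_one

theorem exists_gradForm_nonpos (hsmooth : G.IndividuallySmooth)
    (hD : ∀ X ∈ G.feasible, G.HessianNegDef X) :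
    ∃ X ∈ G.feasible, ∀ Y ∈ G.feasible, G.gradForm X (Y - X) ≤ 0 := by
  refine exists_variational_solution G.isCompact_feasible G.convex_feasible ⟨0, G.zero_mem_feasible⟩ G.gradForm (continuousOn_gradForm hsmooth) ?_
  intro X hX Y hY
  rcases eq_or_ne X Y with rfl | hne
  · exact le_rfl
  · exact (gradForm_sub_lt hsmooth hD hX hY hne).le

theorem isNash_of_gradForm_nonpos (hconc : G.IndividuallyConcave) (hsmooth : G.IndividuallySmooth)
    {X : G.Profile} (hX : X ∈ G.feasible) (h : ∀ Y ∈ G.feasible, G.gradForm X (Y - X) ≤ 0) :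
    G.IsNash X := by
  refine isNash_of_inner_nonpos hconc hsmooth hX fun i Y hY => ?_
  have := h _ (G.update_mem_feasible hX hY)
  rw [gradForm_apply, Finset.sum_eq_single i] at this
  · simpa using this
  · intro j _ hj
    simp [Function.update_of_ne hj]
  · simp

theorem IsNash.gradForm_nonpos (hsmooth : G.IndividuallySmooth) {X : G.Profile} (hX : G.IsNash X)
    {Y : G.Profile} (hY : Y ∈ G.feasible) : G.gradForm X (Y - X) ≤ 0 := by
  rw [gradForm_apply]
  exact Finset.sum_nonpos fun i _ => hX.inner_nonpos hsmooth i (hY i)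

/-- Nash equilibria are strictly variationally stable. -/
theorem IsNash.gradForm_neg (hsmooth : G.IndividuallySmooth)
    (hD : ∀ X ∈ G.feasible, G.HessianNegDef X) {X : G.Profile} (hX : G.IsNash X)
    {Y : G.Profile} (hY : Y ∈ G.feasible) (hne : Y ≠ X) : G.gradForm Y (Y - X) < 0 :=
  (gradForm_sub_lt hsmooth hD hX.1 hY hne.symm).trans_le (hX.gradForm_nonpos hsmooth hY)

theorem IsNash.eq (hsmooth : G.IndividuallySmooth) (hD : ∀ X ∈ G.feasible, G.HessianNegDef X)
    {X Y : G.Profile} (hX : G.IsNash X) (hY : G.IsNash Y) : Y = X := by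
  by_contra hne
  have h1 := hX.gradForm_neg hsmooth hD hY.1 hne
  have h2 := hY.gradForm_nonpos hsmooth hX.1
  rw [← neg_sub, map_neg] at h2
  linarith

/-- Strict stability becomes uniform outside a ball because a continuous function attains its
minimum on the remaining compact set. -/
theorem IsNash.exists_gap (hsmooth : G.IndividuallySmooth)
    (hD : ∀ X ∈ G.feasible, G.HessianNegDef X) {X : G.Profile} (hX : G.IsNash X) {δ : ℝ}
    (hδ : 0 < δ) :
    ∃ c > 0, ∀ Y ∈ G.feasible, δ ≤ dist Y X → c ≤ - G.gradForm Y (Y - X) := by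
  have hK : IsCompact (G.feasible ∩ {Y | δ ≤ dist Y X}) :=
    G.isCompact_feasible.inter_right (isClosed_le continuous_const (by fun_prop))
  rcases (G.feasible ∩ {Y | δ ≤ dist Y X}).eq_empty_or_nonempty with h | h
  · exact ⟨1, one_pos, fun Y hY hd => absurd (h ▸ ⟨hY, hd⟩ : Y ∈ (∅ : Set G.Profile)) (by simp)⟩
  · have hc : ContinuousOn (fun Y => - G.gradForm Y (Y - X)) (G.feasible ∩ {Y | δ ≤ dist Y X}) := by
      refine ContinuousOn.neg ?_
      simp only [gradForm_apply]
      exact continuousOn_finsetSum _ fun i _ =>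
        ((hsmooth.2 i).continuousOn.mono inter_subset_left).inner (by fun_prop)
    obtain ⟨Z, hZ, hmin⟩ := hK.exists_isMinOn h hc
    refine ⟨_, neg_pos.2 (hX.gradForm_neg hsmooth hD hZ.1 ?_), fun Y hY hd => hmin ⟨hY, hd⟩⟩
    rintro rfl
    have := hZ.2
    simp only [mem_ofPred_eq, dist_self] at this
    linarith

theorem IsNash.gap_nonneg (hsmooth : G.IndividuallySmooth)
    (hD : ∀ X ∈ G.feasible, G.HessianNegDef X) {X : G.Profile} (hX : G.IsNash X)
    {Y : G.Profile} (hY : Y ∈ G.feasible) : 0 ≤ - G.gradForm Y (Y - X) := by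
  rcases eq_or_ne Y X with rfl | hne
  · simp
  · exact (neg_pos.2 (hX.gradForm_neg hsmooth hD hY hne)).le

end MatrixGame

theorem ae_summable_of_summable_integral {Ω : Type*} [MeasurableSpace Ω] {μ : Measure Ω}
    {f : ℕ → Ω → ℝ} (hf : ∀ n, Integrable (f n) μ) (hf0 : ∀ n ω, 0 ≤ f n ω)
    (h : Summable fun n => ∫ ω, f n ω ∂μ) : ∀ᵐ ω ∂μ, Summable fun n => f n ω := by
  have h1 : ∫⁻ ω, ∑' n, ENNReal.ofReal (f n ω) ∂μ ≠ ⊤ := by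
    rw [lintegral_tsum fun n => (hf n).aestronglyMeasurable.aemeasurable.ennreal_ofReal]
    simp_rw [← ofReal_integral_eq_lintegral_ofReal (hf _) (ae_of_all _ (hf0 _))]
    exact h.tsum_ofReal_ne_top
  have h2 := ae_lt_top' (AEMeasurable.tsum fun n =>
    (hf n).aestronglyMeasurable.aemeasurable.ennreal_ofReal) h1
  filter_upwards [h2] with ω hω
  have h3 := ENNReal.summable_toReal hω.ne
  exact h3.congr fun n => ENNReal.toReal_ofReal (hf0 n ω)

namespace Herm

variable {m : ℕ}

theorem measurable_ofMatrix {Ω : Type*} [MeasurableSpace Ω] {z : Ω → Matrix (Fin m) (Fin m) ℂ}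
    (hz : ∀ a b, Measurable fun ω => z ω a b) : Measurable fun ω => ofMatrix (z ω) := by
  let L : (Fin m → Fin m → ℂ) →ₗ[ℝ] Herm m :=
    { toFun := fun z => ofMatrix (Matrix.of z)
      map_add' := fun x y => by
        apply toMatrix_injective
        rw [toMatrix_add, toMatrix_ofMatrix, toMatrix_ofMatrix, toMatrix_ofMatrix,
          ← Matrix.of_add_of, Matrix.conjTranspose_add]
        module
      map_smul' := fun r x => by
        apply toMatrix_injective
        rw [RingHom.id_apply, toMatrix_smul, toMatrix_ofMatrix, toMatrix_ofMatrix,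
          ← Matrix.smul_of, Matrix.conjTranspose_smul, star_trivial]
        module }
  exact L.continuous_of_finiteDimensional.measurable.comp
    (measurable_pi_iff.2 fun a => measurable_pi_iff.2 fun b => hz a b)

end Herm

/-! ### Energy estimates along a run. -/

namespace MatrixGame

variable {ι : Type*} [Fintype ι] {G : MatrixGame ι}

theorem singularNorm_le_blockNorm (Z : G.MatrixProfile) (i : ι) :
    singularNorm (Z i) ≤ G.blockNorm Z :=
  le_ciSup (f := fun i => singularNorm (Z i)) (Finite.bddAbove_range _) i

omit [Fintype ι] in
theorem blockNorm_nonneg (Z : G.MatrixProfile) : 0 ≤ G.blockNorm Z :=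
  Real.iSup_nonneg fun _ => Herm.singularNorm_nonneg _

/-- The Fenchel coupling between a score profile `Y` and the profile `X`, up to a constant. -/
noncomputable def energy (X Y : G.Profile) : ℝ :=
  ∑ i, (G.A i * (Y i).logPart - inner ℝ (Y i) (X i))

theorem energy_nonneg {X : G.Profile} (hX : X ∈ G.feasible) (Y : G.Profile) : 0 ≤ energy X Y :=
  Finset.sum_nonneg fun i _ => sub_nonneg.2 (Herm.inner_le_mul_logPart (hX i).1 (hX i).2 (Y i))

variable [DecidableEq ι]

theorem exists_norm_grad_le (hsmooth : G.IndividuallySmooth) :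
    ∃ B, 0 ≤ B ∧ ∀ X ∈ G.feasible, ∀ i, ‖G.grad i X‖ ≤ B := by
  have h : ∀ i, ∃ B, ∀ X ∈ G.feasible, ‖G.grad i X‖ ≤ B := fun i =>
    G.isCompact_feasible.exists_bound_of_continuousOn (hsmooth.2 i).continuousOn
  choose B hB using h
  refine ⟨∑ i, |B i|, Finset.sum_nonneg fun _ _ => abs_nonneg _, fun X hX i => ?_⟩
  exact (hB i X hX).trans ((le_abs_self _).trans
    (Finset.single_le_sum (f := fun i => |B i|) (fun _ _ => abs_nonneg _) (Finset.mem_univ i)))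

variable (G) in
/-- One step of matrix exponential learning on the scores. -/
noncomputable def scoreStep (g : ℝ) (z : G.MatrixProfile) (Y : G.Profile) : G.Profile := fun i =>
  Y i + g • Herm.ofMatrix ((G.grad i (G.choice Y)).toMatrix + z i)

/-- The noise term in the evolution of the energy. -/
noncomputable def noiseForm (X : G.Profile) (z : G.MatrixProfile) (Y : G.Profile) : ℝ :=
  ∑ i, inner ℝ (G.choice Y i - X i) (Herm.ofMatrix (z i))

/-- As a function of the scores, the energy is smooth with gradient `choice Y - X`, so `logPart_le`
is its second-order bound. The displacement is `O(g (1 + ‖z‖))` because gradients are bounded on the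
compact feasible set. -/
theorem exists_step_bound (hsmooth : G.IndividuallySmooth) :
    ∃ K, 0 ≤ K ∧ ∀ (X Y : G.Profile) (z : G.MatrixProfile) (g : ℝ), 0 ≤ g →
      dist (G.choice Y) (G.choice (G.scoreStep g z Y)) ≤ K * (g * (1 + G.blockNorm z)) ∧
      energy X (G.scoreStep g z Y) ≤ energy X Y + g * G.gradForm (G.choice Y) (G.choice Y - X) +
        g * noiseForm X z Y + K * (g * (1 + G.blockNorm z)) ^ 2 := by
  obtain ⟨B, hB0, hB⟩ := exists_norm_grad_le hsmooth
  let c : ι → ℝ := fun i => G.A i * (1 + ‖Herm.one (G.M i)‖)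
  -- `B` bounds the gradient; the matrix size converts the singular norm of the noise into the norm
  -- of the trace inner product.
  let d : ι → ℝ := fun i => B + G.M i
  have hc : ∀ i, 0 ≤ c i := fun i => mul_nonneg (G.A_pos i).le (by positivity)
  have hd : ∀ i, 0 ≤ d i := fun i => by positivity
  have hstep : ∀ (Y : G.Profile) (z : G.MatrixProfile) (g : ℝ), 0 ≤ g → ∀ i,
      ‖G.scoreStep g z Y i - Y i‖ ≤ d i * (g * (1 + G.blockNorm z)) := by
    intro Y z g hg i
    rw [scoreStep, add_sub_cancel_left, norm_smul, Real.norm_of_nonneg hg,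
      Herm.ofMatrix_toMatrix_add]
    have h1 := norm_add_le (G.grad i (G.choice Y)) (Herm.ofMatrix (z i))
    have h2 := hB _ (G.choice_mem_feasible Y) i
    have h3 := Herm.norm_ofMatrix_le (z i)
    have h4 := mul_le_mul_of_nonneg_left (singularNorm_le_blockNorm z i)
      (Nat.cast_nonneg (α := ℝ) (G.M i))
    have h5 := blockNorm_nonneg z
    have h6 : ‖G.grad i (G.choice Y) + Herm.ofMatrix (z i)‖ ≤ d i * (1 + G.blockNorm z) := by
      simp only [d]
      nlinarith [mul_nonneg hB0 h5, Nat.cast_nonneg (α := ℝ) (G.M i)]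
    nlinarith [mul_le_mul_of_nonneg_left h6 hg]
  refine ⟨∑ i, (c i * d i + c i * d i ^ 2), Finset.sum_nonneg fun i _ => ?_,
    fun X Y z g hg => ⟨?_, ?_⟩⟩
  · have := hc i
    have := hd i
    positivity
  · have hb : 0 ≤ g * (1 + G.blockNorm z) := mul_nonneg hg (by linarith [blockNorm_nonneg z])
    refine (dist_pi_le_iff (mul_nonneg (Finset.sum_nonneg fun i _ => ?_) hb)).2 fun i => ?_
    · have := hc i
      have := hd i
      positivity
    · rw [dist_comm, dist_eq_norm]
      refine (Herm.norm_expProj_sub_le (G.A_pos i).le _ _).trans ?_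
      refine (mul_le_mul_of_nonneg_left (hstep Y z g hg i) (hc i)).trans ?_
      rw [← mul_assoc]
      refine mul_le_mul_of_nonneg_right ?_ hb
      refine le_trans ?_ (Finset.single_le_sum (f := fun i => c i * d i + c i * d i ^ 2)
        (fun i _ => ?_) (Finset.mem_univ i))
      · have := mul_nonneg (hc i) (sq_nonneg (d i))
        linarith
      · have := hc i
        have := hd i
        positivity
  · rw [energy, energy, gradForm_apply, noiseForm, Finset.sum_mul, Finset.mul_sum, Finset.mul_sum,
      ← Finset.sum_add_distrib, ← Finset.sum_add_distrib, ← Finset.sum_add_distrib]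
    refine Finset.sum_le_sum fun i _ => ?_
    have h1 := mul_le_mul_of_nonneg_left (Herm.logPart_le (G.scoreStep g z Y i) (Y i)) (G.A_pos i).le
    have h2 : ‖G.scoreStep g z Y i - Y i‖ ^ 2 ≤ (d i * (g * (1 + G.blockNorm z))) ^ 2 :=
      pow_le_pow_left₀ (norm_nonneg _) (hstep Y z g hg i) 2
    have h3 := mul_le_mul_of_nonneg_left h2 (hc i)
    have h4 : G.scoreStep g z Y i - Y i =
        g • (G.grad i (G.choice Y) + Herm.ofMatrix (z i)) := by
      rw [scoreStep, add_sub_cancel_left, Herm.ofMatrix_toMatrix_add]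
    have h5 : inner ℝ (G.scoreStep g z Y i) (X i) = inner ℝ (Y i) (X i) +
        g * inner ℝ (X i) (G.grad i (G.choice Y)) + g * inner ℝ (X i) (Herm.ofMatrix (z i)) := by
      rw [eq_add_of_sub_eq' h4, inner_add_left, real_inner_smul_left, inner_add_left,
        real_inner_comm (X i) (G.grad i _), real_inner_comm (X i) (Herm.ofMatrix _)]
      ring
    have h6 : G.A i * inner ℝ (Y i).shift.exp (G.scoreStep g z Y i - Y i) =
        g * inner ℝ (G.choice Y i) (G.grad i (G.choice Y)) +
        g * inner ℝ (G.choice Y i) (Herm.ofMatrix (z i)) := by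
      have : G.choice Y i = G.A i • (Y i).shift.exp := Herm.expProj_eq _ _
      rw [this, h4, inner_smul_right, inner_add_right, real_inner_smul_left, real_inner_smul_left]
      ring
    have h7 : 0 ≤ c i * d i * (g * (1 + G.blockNorm z)) ^ 2 :=
      mul_nonneg (mul_nonneg (hc i) (hd i)) (sq_nonneg _)
    simp only [c] at h3 h7 ⊢
    rw [h5, inner_sub_left, Pi.sub_apply, inner_sub_right,
      real_inner_comm (G.choice Y i) (G.grad i (G.choice Y)),
      real_inner_comm (X i) (G.grad i (G.choice Y))]
    nlinarith

end MatrixGame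

namespace MatrixGame

variable {ι : Type*} [Fintype ι] [DecidableEq ι] {G : MatrixGame ι}

/-- A pathwise telescoping of the energy. The constants do not depend on the noise or the horizon,
so the bound can be averaged afterwards. -/
theorem sum_weight_le (hsmooth : G.IndividuallySmooth) (hD : ∀ X ∈ G.feasible, G.HessianNegDef X)
    {Xs : G.Profile} (hXs : G.IsNash Xs) {γ : ℕ → ℝ} (hγ : ∀ n, 0 < γ n) (Y₀ : G.Profile) {δ : ℝ}
    (hδ : 0 < δ) : ∃ c > 0, ∃ K, 0 ≤ K ∧ ∀ (z : ℕ → G.MatrixProfile) (N : ℕ),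
      c * ∑ n ∈ Finset.range N, {n | δ ≤ dist (G.mxl γ Y₀ z n) Xs}.indicator γ n ≤
      energy Xs Y₀ + ∑ n ∈ Finset.range N, γ n * noiseForm Xs (z n) (G.score γ Y₀ z n) +
        ∑ n ∈ Finset.range N, K * (γ n * (1 + G.blockNorm (z n))) ^ 2 := by
  obtain ⟨c, hc, hgap⟩ := hXs.exists_gap hsmooth hD hδ
  obtain ⟨K, hK, hstep⟩ := exists_step_bound hsmooth
  refine ⟨c, hc, K, hK, fun z N => ?_⟩
  suffices h : energy Xs (G.score γ Y₀ z N) +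
      c * ∑ n ∈ Finset.range N, {n | δ ≤ dist (G.mxl γ Y₀ z n) Xs}.indicator γ n ≤
      energy Xs Y₀ + ∑ n ∈ Finset.range N, γ n * noiseForm Xs (z n) (G.score γ Y₀ z n) +
        ∑ n ∈ Finset.range N, K * (γ n * (1 + G.blockNorm (z n))) ^ 2 by
    linarith [energy_nonneg hXs.1 (G.score γ Y₀ z N)]
  induction N with
  | zero => simp [score]
  | succ N ih =>
    rw [Finset.sum_range_succ, Finset.sum_range_succ, Finset.sum_range_succ]
    have h1 := (hstep Xs (G.score γ Y₀ z N) (z N) (γ N) (hγ N).le).2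
    have h2 : G.score γ Y₀ z (N + 1) = G.scoreStep (γ N) (z N) (G.score γ Y₀ z N) := rfl
    have h3 : c * {n | δ ≤ dist (G.mxl γ Y₀ z n) Xs}.indicator γ N ≤
        - (γ N * G.gradForm (G.choice (G.score γ Y₀ z N)) (G.choice (G.score γ Y₀ z N) - Xs)) := by
      have hf := G.choice_mem_feasible (G.score γ Y₀ z N)
      by_cases h : δ ≤ dist (G.mxl γ Y₀ z N) Xs
      · rw [indicator_of_mem (s := {n | δ ≤ dist (G.mxl γ Y₀ z n) Xs}) h]
        nlinarith [hgap _ hf h, hγ N]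
      · rw [indicator_of_notMem (s := {n | δ ≤ dist (G.mxl γ Y₀ z n) Xs}) h]
        nlinarith [hXs.gap_nonneg hsmooth hD hf, hγ N]
    rw [h2]
    linarith

section Measurability

variable {Ω : Type*} [MeasurableSpace Ω] {Z : ℕ → Ω → G.MatrixProfile}

theorem measurable_score (hsmooth : G.IndividuallySmooth) (γ : ℕ → ℝ) (Y₀ : G.Profile)
    (hZ : ∀ n i a b, Measurable fun ω => Z n ω i a b) (n : ℕ) :
    Measurable fun ω => G.score γ Y₀ (fun k => Z k ω) n := by
  induction n with
  | zero => exact measurable_const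
  | succ n ih =>
    refine measurable_pi_iff.2 fun i => ?_
    simp only [score, Herm.ofMatrix_toMatrix_add]
    have hg : Continuous fun Y => G.grad i (G.choice Y) :=
      (hsmooth.2 i).continuousOn.comp_continuous G.continuous_choice G.choice_mem_feasible
    exact ((measurable_pi_apply i).comp ih).add
      (((hg.measurable.comp ih).add (Herm.measurable_ofMatrix (hZ n i))).const_smul (γ n))

theorem measurable_mxl (hsmooth : G.IndividuallySmooth) (γ : ℕ → ℝ) (Y₀ : G.Profile)
    (hZ : ∀ n i a b, Measurable fun ω => Z n ω i a b) (n : ℕ) :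
    Measurable fun ω => G.mxl γ Y₀ (fun k => Z k ω) n :=
  G.continuous_choice.measurable.comp (measurable_score hsmooth γ Y₀ hZ n)

end Measurability

/-! ### Expectations and almost sure convergence. -/

namespace IsAdmissibleNoise

variable {Ω : Type*} [mΩ : MeasurableSpace Ω] {μ : Measure Ω} [IsProbabilityMeasure μ] {γ : ℕ → ℝ}
  {Y₀ : G.Profile} {Z : ℕ → Ω → G.MatrixProfile} {σ : ℝ}

omit [Fintype ι] in
theorem integrable_blockNorm (hZ : G.IsAdmissibleNoise μ γ Y₀ Z σ) (n : ℕ) :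
    Integrable (fun ω => G.blockNorm (Z n ω)) μ := by
  have h := hZ.integrable_sq n
  have hm : AEStronglyMeasurable (fun ω => G.blockNorm (Z n ω)) μ := by
    have := (Real.continuous_sqrt.comp_aestronglyMeasurable h.aestronglyMeasurable)
    refine this.congr (ae_of_all _ fun ω => ?_)
    exact Real.sqrt_sq (blockNorm_nonneg _)
  refine Integrable.mono' (h.add (integrable_const 1)) hm (ae_of_all _ fun ω => ?_)
  rw [Real.norm_of_nonneg (blockNorm_nonneg _), Pi.add_apply]
  nlinarith [sq_nonneg (G.blockNorm (Z n ω) - 1 / 2)]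

omit [Fintype ι] in
theorem integrable_one_add_sq (hZ : G.IsAdmissibleNoise μ γ Y₀ Z σ) (n : ℕ) :
    Integrable (fun ω => (1 + G.blockNorm (Z n ω)) ^ 2) μ := by
  have : (fun ω => (1 + G.blockNorm (Z n ω)) ^ 2) = fun ω =>
      1 + 2 * G.blockNorm (Z n ω) + G.blockNorm (Z n ω) ^ 2 := by
    ext ω
    ring
  rw [this]
  exact ((integrable_const 1).add ((hZ.integrable_blockNorm n).const_mul 2)).add
    (hZ.integrable_sq n)

/-- The event depends on `X(n)` alone, hence lies in the conditioning σ-algebra. -/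
theorem setIntegral_sq_le (hZ : G.IsAdmissibleNoise μ γ Y₀ Z σ) (hsmooth : G.IndividuallySmooth)
    (n : ℕ) {S : Set G.Profile} (hS : MeasurableSet S) :
    ∫ ω in (fun ω => G.mxl γ Y₀ (fun k => Z k ω) n) ⁻¹' S, G.blockNorm (Z n ω) ^ 2 ∂μ ≤
      σ ^ 2 * μ.real ((fun ω => G.mxl γ Y₀ (fun k => Z k ω) n) ⁻¹' S) := by
  have hle := (measurable_mxl hsmooth γ Y₀ hZ.measurable n).comap_le
  rw [← setIntegral_condExp hle (hZ.integrable_sq n) ⟨S, hS, rfl⟩]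
  refine (setIntegral_mono_ae integrable_condExp.integrableOn (integrable_const (σ ^ 2)).integrableOn
    (hZ.mean_sq n)).trans (le_of_eq ?_)
  rw [setIntegral_const, smul_eq_mul, mul_comm]

theorem setIntegral_one_add_le (hZ : G.IsAdmissibleNoise μ γ Y₀ Z σ)
    (hsmooth : G.IndividuallySmooth) (n : ℕ) {S : Set G.Profile} (hS : MeasurableSet S) :
    ∫ ω in (fun ω => G.mxl γ Y₀ (fun k => Z k ω) n) ⁻¹' S, (1 + G.blockNorm (Z n ω)) ∂μ ≤
      (2 + σ ^ 2) * μ.real ((fun ω => G.mxl γ Y₀ (fun k => Z k ω) n) ⁻¹' S) := by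
  have h1 := hZ.setIntegral_sq_le hsmooth n hS
  have h2 : ∫ ω in (fun ω => G.mxl γ Y₀ (fun k => Z k ω) n) ⁻¹' S, (1 + G.blockNorm (Z n ω)) ∂μ ≤
      ∫ ω in (fun ω => G.mxl γ Y₀ (fun k => Z k ω) n) ⁻¹' S,
        (2 + G.blockNorm (Z n ω) ^ 2) ∂μ := by
    refine setIntegral_mono ((integrable_const 1).add (hZ.integrable_blockNorm n)).integrableOn
      ((integrable_const 2).add (hZ.integrable_sq n)).integrableOn fun ω => ?_
    change 1 + G.blockNorm (Z n ω) ≤ 2 + G.blockNorm (Z n ω) ^ 2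
    nlinarith [sq_nonneg (G.blockNorm (Z n ω) - 1 / 2)]
  refine h2.trans ?_
  rw [integral_add (integrable_const 2) (hZ.integrable_sq n).integrableOn, setIntegral_const,
    smul_eq_mul]
  linarith

theorem integral_one_add_sq_le (hZ : G.IsAdmissibleNoise μ γ Y₀ Z σ)
    (hsmooth : G.IndividuallySmooth) (n : ℕ) :
    ∫ ω, (1 + G.blockNorm (Z n ω)) ^ 2 ∂μ ≤ 2 + 2 * σ ^ 2 := by
  have h1 := hZ.setIntegral_sq_le hsmooth n MeasurableSet.univ
  simp only [preimage_univ, Measure.restrict_univ, probReal_univ, mul_one] at h1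
  have h2 : ∫ ω, (1 + G.blockNorm (Z n ω)) ^ 2 ∂μ ≤ ∫ ω, (2 + 2 * G.blockNorm (Z n ω) ^ 2) ∂μ := by
    refine integral_mono (hZ.integrable_one_add_sq n)
      ((integrable_const 2).add ((hZ.integrable_sq n).const_mul 2)) fun ω => ?_
    change (1 + G.blockNorm (Z n ω)) ^ 2 ≤ 2 + 2 * G.blockNorm (Z n ω) ^ 2
    nlinarith [sq_nonneg (G.blockNorm (Z n ω) - 1)]
  refine h2.trans ?_
  rw [integral_add (integrable_const 2) ((hZ.integrable_sq n).const_mul 2), integral_const_mul,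
    integral_const, probReal_univ, one_smul]
  linarith

theorem integrable_apply (hZ : G.IsAdmissibleNoise μ γ Y₀ Z σ) (n : ℕ) (i : ι)
    (a b : Fin (G.M i)) : Integrable (fun ω => Z n ω i a b) μ :=
  (hZ.integrable_blockNorm n).mono' (hZ.measurable n i a b).aestronglyMeasurable
    (ae_of_all _ fun ω => (Herm.norm_apply_le_singularNorm _ a b).trans
      (singularNorm_le_blockNorm (Z n ω) i))

/-- The factor `f (X(n))` is bounded, by compactness, and measurable for the conditioning σ-algebra,
so it can be pulled out of the conditional expectation. -/
theorem integrable_mul_and_integral_eq_zero (hZ : G.IsAdmissibleNoise μ γ Y₀ Z σ)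
    (hsmooth : G.IndividuallySmooth) (n : ℕ) (i : ι) (a b : Fin (G.M i)) {f : G.Profile → ℂ}
    (hf : Continuous f) :
    Integrable (fun ω => f (G.mxl γ Y₀ (fun k => Z k ω) n) * Z n ω i a b) μ ∧
      ∫ ω, f (G.mxl γ Y₀ (fun k => Z k ω) n) * Z n ω i a b ∂μ = 0 := by
  have hm := measurable_mxl hsmooth γ Y₀ hZ.measurable n
  obtain ⟨C, hC⟩ := G.isCompact_feasible.exists_bound_of_continuousOn hf.continuousOn
  have hi : Integrable (fun ω => f (G.mxl γ Y₀ (fun k => Z k ω) n) * Z n ω i a b) μ :=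
    (hZ.integrable_apply n i a b).bdd_mul (c := C)
      (hf.measurable.comp hm).aestronglyMeasurable
      (ae_of_all _ fun ω => hC _ (G.choice_mem_feasible _))
  refine ⟨hi, ?_⟩
  have hsm : StronglyMeasurable[MeasurableSpace.comap
      (fun ω => G.mxl γ Y₀ (fun k => Z k ω) n) inferInstance]
      (fun ω => f (G.mxl γ Y₀ (fun k => Z k ω) n)) :=
    (hf.measurable.comp (comap_measurable _)).stronglyMeasurable
  have h := condExp_bilin_of_stronglyMeasurable_left (ContinuousLinearMap.mul ℝ ℂ) hsm
    (by simpa using hi) (hZ.integrable_apply n i a b)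
  rw [← integral_condExp hm.comap_le]
  refine integral_eq_zero_of_ae ?_
  filter_upwards [h, hZ.zero_mean n i a b] with ω h1 h2
  simp only [ContinuousLinearMap.mul_apply'] at h1
  rw [h1, h2]
  simp

theorem integrable_noiseForm_and_integral_eq_zero (hZ : G.IsAdmissibleNoise μ γ Y₀ Z σ)
    (hsmooth : G.IndividuallySmooth) (Xs : G.Profile) (n : ℕ) :
    Integrable (fun ω => noiseForm Xs (Z n ω) (G.score γ Y₀ (fun k => Z k ω) n)) μ ∧
      ∫ ω, noiseForm Xs (Z n ω) (G.score γ Y₀ (fun k => Z k ω) n) ∂μ = 0 := by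
  have hc : ∀ i a b, Continuous fun X : G.Profile => (X i - Xs i).toMatrix a b := fun i a b =>
    (Herm.continuous_toMatrix.comp (by fun_prop)).matrix_elem a b
  have h : ∀ i a b, _ := fun i a b =>
    hZ.integrable_mul_and_integral_eq_zero hsmooth n i b a (hc i a b)
  have heq : (fun ω => noiseForm Xs (Z n ω) (G.score γ Y₀ (fun k => Z k ω) n)) = fun ω =>
      ∑ i, ∑ a, ∑ b, Complex.reCLM
        ((G.mxl γ Y₀ (fun k => Z k ω) n i - Xs i).toMatrix a b * Z n ω i b a) := by
    ext ω
    simp only [noiseForm, Herm.inner_ofMatrix, Complex.re_sum]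
    rfl
  rw [heq]
  have hi : ∀ i a b, Integrable (fun ω => Complex.reCLM
      ((G.mxl γ Y₀ (fun k => Z k ω) n i - Xs i).toMatrix a b * Z n ω i b a)) μ := fun i a b =>
    Complex.reCLM.integrable_comp (h i a b).1
  have hi1 : ∀ i a, Integrable (fun ω => ∑ b, Complex.reCLM
      ((G.mxl γ Y₀ (fun k => Z k ω) n i - Xs i).toMatrix a b * Z n ω i b a)) μ := fun i a =>
    integrable_finsetSum _ fun b _ => hi i a b
  have hi2 : ∀ i, Integrable (fun ω => ∑ a, ∑ b, Complex.reCLM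
      ((G.mxl γ Y₀ (fun k => Z k ω) n i - Xs i).toMatrix a b * Z n ω i b a)) μ := fun i =>
    integrable_finsetSum _ fun a _ => hi1 i a
  refine ⟨integrable_finsetSum _ fun i _ => hi2 i, ?_⟩
  rw [integral_finsetSum _ fun i _ => hi2 i]
  refine Finset.sum_eq_zero fun i _ => ?_
  rw [integral_finsetSum _ fun a _ => hi1 i a]
  refine Finset.sum_eq_zero fun a _ => ?_
  rw [integral_finsetSum _ fun b _ => hi i a b]
  refine Finset.sum_eq_zero fun b _ => ?_
  rw [Complex.reCLM.integral_comp_comm (h i a b).1, (h i a b).2, map_zero]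

/-- Expectation of `sum_weight_le`: the noise terms vanish, and the quadratic ones are dominated by
a multiple of `∑ γ_n²`. -/
theorem summable_measure (hZ : G.IsAdmissibleNoise μ γ Y₀ Z σ) (hsmooth : G.IndividuallySmooth)
    (hD : ∀ X ∈ G.feasible, G.HessianNegDef X) {Xs : G.Profile} (hXs : G.IsNash Xs)
    (hγ : ∀ n, 0 < γ n) (hγ2 : Summable fun n => γ n ^ 2) {δ : ℝ} (hδ : 0 < δ) :
    Summable fun n => γ n * μ.real ((fun ω => G.mxl γ Y₀ (fun k => Z k ω) n) ⁻¹'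
      {X | δ ≤ dist X Xs}) := by
  obtain ⟨c, hc, K, hK, hsum⟩ := sum_weight_le hsmooth hD hXs hγ Y₀ hδ
  have hS : MeasurableSet {X | δ ≤ dist X Xs} :=
    (isClosed_le continuous_const (continuous_id.dist continuous_const)).measurableSet
  have hSm := fun n => measurable_mxl hsmooth γ Y₀ hZ.measurable n hS
  have hind : ∀ n ω, {n | δ ≤ dist (G.mxl γ Y₀ (fun k => Z k ω) n) Xs}.indicator γ n =
      ((fun ω => G.mxl γ Y₀ (fun k => Z k ω) n) ⁻¹' {X | δ ≤ dist X Xs}).indicator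
        (fun _ => γ n) ω := fun n ω => by
    simp [indicator]
  have hI : ∀ n, Integrable (((fun ω => G.mxl γ Y₀ (fun k => Z k ω) n) ⁻¹'
      {X | δ ≤ dist X Xs}).indicator (fun _ => γ n)) μ :=
    fun n => (integrable_const _).indicator (hSm n)
  refine summable_of_sum_range_le (c := c⁻¹ * (energy Xs Y₀ +
    ∑' n, K * (2 + 2 * σ ^ 2) * γ n ^ 2)) (fun n => by have := (hγ n).le; positivity) fun N => ?_
  rw [← mul_le_mul_iff_right₀ hc, mul_inv_cancel_left₀ hc.ne']
  have hN := fun n => hZ.integrable_noiseForm_and_integral_eq_zero hsmooth Xs n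
  have hQ : ∀ n, Integrable (fun ω => K * (γ n * (1 + G.blockNorm (Z n ω))) ^ 2) μ := fun n => by
    simp_rw [mul_pow]
    exact ((hZ.integrable_one_add_sq n).const_mul _).const_mul _
  have hSN : Integrable (fun ω => ∑ n ∈ Finset.range N, γ n * noiseForm Xs (Z n ω)
      (G.score γ Y₀ (fun k => Z k ω) n)) μ :=
    integrable_finsetSum _ fun n _ => (hN n).1.const_mul _
  have hEN : Integrable (fun ω => energy Xs Y₀ + ∑ n ∈ Finset.range N, γ n *
      noiseForm Xs (Z n ω) (G.score γ Y₀ (fun k => Z k ω) n)) μ := (integrable_const _).add hSN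
  have hQN : Integrable (fun ω => ∑ n ∈ Finset.range N,
      K * (γ n * (1 + G.blockNorm (Z n ω))) ^ 2) μ := integrable_finsetSum _ fun n _ => hQ n
  have h1 : ∫ ω, c * ∑ n ∈ Finset.range N, ((fun ω => G.mxl γ Y₀ (fun k => Z k ω) n) ⁻¹'
      {X | δ ≤ dist X Xs}).indicator (fun _ => γ n) ω ∂μ ≤
      ∫ ω, (energy Xs Y₀ + ∑ n ∈ Finset.range N, γ n * noiseForm Xs (Z n ω)
        (G.score γ Y₀ (fun k => Z k ω) n) +
        ∑ n ∈ Finset.range N, K * (γ n * (1 + G.blockNorm (Z n ω))) ^ 2) ∂μ := by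
    refine integral_mono ((integrable_finsetSum _ fun n _ => hI n).const_mul c)
      (hEN.add hQN) fun ω => ?_
    have := hsum (fun k => Z k ω) N
    simp only [hind] at this
    exact this
  rw [integral_const_mul, integral_finsetSum _ fun n _ => hI n, integral_add hEN hQN,
    integral_add (integrable_const _) hSN, integral_const, probReal_univ,
    one_smul, integral_finsetSum _ fun n _ => (hN n).1.const_mul _,
    integral_finsetSum _ fun n _ => hQ n] at h1
  simp only [integral_const_mul, (hN _).2, mul_zero, Finset.sum_const_zero, add_zero,
    integral_indicator_const _ (hSm _), smul_eq_mul, mul_pow] at h1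
  simp only [mul_comm (γ _)]
  refine h1.trans (add_le_add_right ?_ _)
  have hs : Summable fun n => K * (2 + 2 * σ ^ 2) * γ n ^ 2 := hγ2.mul_left _
  refine le_trans (Finset.sum_le_sum fun n _ => ?_)
    (hs.sum_le_tsum (Finset.range N) fun n _ => by positivity)
  have := mul_le_mul_of_nonneg_left (hZ.integral_one_add_sq_le hsmooth n)
    (mul_nonneg hK (sq_nonneg (γ n)))
  linarith

/-- Up to a constant this is the path length spent outside the ball. Given `X(n)`, the mean of `1 +
‖Z(n)‖` is bounded, so `summable_measure` bounds the expected length. -/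
theorem ae_summable_indicator (hZ : G.IsAdmissibleNoise μ γ Y₀ Z σ)
    (hsmooth : G.IndividuallySmooth) (hD : ∀ X ∈ G.feasible, G.HessianNegDef X) {Xs : G.Profile}
    (hXs : G.IsNash Xs) (hγ : ∀ n, 0 < γ n) (hγ2 : Summable fun n => γ n ^ 2) {δ : ℝ}
    (hδ : 0 < δ) : ∀ᵐ ω ∂μ, Summable
      ({n | δ ≤ dist (G.mxl γ Y₀ (fun k => Z k ω) n) Xs}.indicator
        fun n => γ n * (1 + G.blockNorm (Z n ω))) := by
  have hS : MeasurableSet {X | δ ≤ dist X Xs} :=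
    (isClosed_le continuous_const (continuous_id.dist continuous_const)).measurableSet
  have hSm := fun n => measurable_mxl hsmooth γ Y₀ hZ.measurable n hS
  have hI : ∀ n, Integrable (fun ω => γ n * (1 + G.blockNorm (Z n ω))) μ := fun n =>
    ((integrable_const 1).add (hZ.integrable_blockNorm n)).const_mul _
  have hnn : ∀ n ω, 0 ≤ γ n * (1 + G.blockNorm (Z n ω)) := fun n ω =>
    mul_nonneg (hγ n).le (by linarith [blockNorm_nonneg (Z n ω)])
  have h := ae_summable_of_summable_integral (μ := μ)
    (f := fun n => ((fun ω => G.mxl γ Y₀ (fun k => Z k ω) n) ⁻¹' {X | δ ≤ dist X Xs}).indicator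
      fun ω => γ n * (1 + G.blockNorm (Z n ω)))
    (fun n => (hI n).indicator (hSm n)) (fun n ω => indicator_nonneg (fun ω _ => hnn n ω) ω) ?_
  · filter_upwards [h] with ω hω
    refine hω.congr fun n => ?_
    simp [indicator]
  · refine Summable.of_nonneg_of_le
      (fun n => integral_nonneg fun ω => indicator_nonneg (fun ω _ => hnn n ω) ω) (fun n => ?_)
      ((hZ.summable_measure hsmooth hD hXs hγ hγ2 hδ).mul_left (2 + σ ^ 2))
    rw [integral_indicator (hSm n), integral_const_mul]
    have := mul_le_mul_of_nonneg_left (hZ.setIntegral_one_add_le hsmooth n hS) (hγ n).le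
    linarith

theorem ae_tendsto_zero (hZ : G.IsAdmissibleNoise μ γ Y₀ Z σ) (hsmooth : G.IndividuallySmooth)
    (hγ : ∀ n, 0 < γ n) (hγ2 : Summable fun n => γ n ^ 2) :
    ∀ᵐ ω ∂μ, Tendsto (fun n => γ n * (1 + G.blockNorm (Z n ω))) atTop (𝓝 0) := by
  have h := ae_summable_of_summable_integral (μ := μ)
    (f := fun n ω => γ n ^ 2 * (1 + G.blockNorm (Z n ω)) ^ 2)
    (fun n => (hZ.integrable_one_add_sq n).const_mul _) (fun n ω => by positivity) ?_
  · filter_upwards [h] with ω hω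
    have h1 := (Real.continuous_sqrt.tendsto 0).comp hω.tendsto_atTop_zero
    rw [Real.sqrt_zero] at h1
    refine h1.congr fun n => ?_
    rw [Function.comp_apply, ← mul_pow, Real.sqrt_sq
      (mul_nonneg (hγ n).le (by linarith [blockNorm_nonneg (Z n ω)]))]
  · refine Summable.of_nonneg_of_le (fun n => integral_nonneg fun ω => by positivity) (fun n => ?_)
      (hγ2.mul_right (2 + 2 * σ ^ 2))
    rw [integral_const_mul]
    exact mul_le_mul_of_nonneg_left (hZ.integral_one_add_sq_le hsmooth n) (sq_nonneg _)

/-- Matrix exponential learning converges almost surely to Nash equilibrium. -/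
theorem ae_tendsto_mxl (hZ : G.IsAdmissibleNoise μ γ Y₀ Z σ) (hsmooth : G.IndividuallySmooth)
    (hD : ∀ X ∈ G.feasible, G.HessianNegDef X) {Xs : G.Profile} (hXs : G.IsNash Xs)
    (hγ : ∀ n, 0 < γ n) (hγ2 : Summable fun n => γ n ^ 2) (hγs : ¬ Summable γ) :
    ∀ᵐ ω ∂μ, Tendsto (fun n => G.mxl γ Y₀ (fun k => Z k ω) n) atTop (𝓝 Xs) := by
  obtain ⟨K, hK, hstep⟩ := exists_step_bound hsmooth
  -- Countably many radii suffice, which leaves a single null set; smaller radii give larger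
  -- indicators.
  have h1 := fun k : ℕ => hZ.ae_summable_indicator hsmooth hD hXs hγ hγ2
    (δ := 1 / ((k : ℝ) + 1)) Nat.one_div_pos_of_nat
  filter_upwards [ae_all_iff.2 h1, hZ.ae_tendsto_zero hsmooth hγ hγ2] with ω hω hω0
  have hnn : ∀ n, 0 ≤ γ n * (1 + G.blockNorm (Z n ω)) := fun n =>
    mul_nonneg (hγ n).le (by linarith [blockNorm_nonneg (Z n ω)])
  have hall : ∀ δ > 0, Summable ({n | δ ≤ dist (G.mxl γ Y₀ (fun k => Z k ω) n) Xs}.indicator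
      fun n => γ n * (1 + G.blockNorm (Z n ω))) := by
    intro δ hδ
    obtain ⟨k, hk⟩ := exists_nat_one_div_lt hδ
    refine Summable.of_nonneg_of_le (fun n => indicator_nonneg (fun n _ => hnn n) n) (fun n => ?_)
      (hω k)
    exact indicator_le_indicator_of_subset (fun n hn => hk.le.trans hn) hnn n
  refine tendsto_of_summable_indicator (γ := γ)
    (l := fun n => K * (γ n * (1 + G.blockNorm (Z n ω)))) hγs
    (fun n => (hstep Xs _ (Z n ω) (γ n) (hγ n).le).1) (by simpa using hω0.const_mul K)
    (fun δ hδ => ?_) (fun δ hδ => ?_)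
  · refine Summable.of_nonneg_of_le (fun n => indicator_nonneg (fun n _ => (hγ n).le) n)
      (fun n => ?_) (hall δ hδ)
    refine indicator_le_indicator ?_
    nlinarith [hγ n, blockNorm_nonneg (Z n ω)]
  · refine ((hall δ hδ).mul_left K).congr fun n => ?_
    simp [indicator]

end IsAdmissibleNoise

end MatrixGame

theorem mainTheorem5 {ι : Type*} [Fintype ι] [DecidableEq ι] (G : MatrixGame ι)
    (hconc : G.IndividuallyConcave) (hsmooth : G.IndividuallySmooth)
    (hD : ∀ X ∈ G.feasible, G.HessianNegDef X) :
    ∃ Xstar : G.Profile, G.IsNash Xstar ∧ (∀ X : G.Profile, G.IsNash X → X = Xstar) ∧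
      ∀ {Ω : Type*} [MeasurableSpace Ω] (μ : Measure Ω) [IsProbabilityMeasure μ]
        (γ : ℕ → ℝ) (Y₀ : G.Profile) (Z : ℕ → Ω → G.MatrixProfile) (σ : ℝ),
        (∀ n, 0 < γ n) → (Summable fun n => γ n ^ 2) → (¬ Summable γ) → 0 < σ →
        G.IsAdmissibleNoise μ γ Y₀ Z σ →
        ∀ᵐ ω ∂μ, Tendsto (fun n => G.mxl γ Y₀ (fun k => Z k ω) n) atTop (𝓝 Xstar) := by
  obtain ⟨X, hX, hvi⟩ := MatrixGame.exists_gradForm_nonpos hsmooth hD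
  have hnash := MatrixGame.isNash_of_gradForm_nonpos hconc hsmooth hX hvi
  refine ⟨X, hnash, fun Y hY => hnash.eq hsmooth hD hY, ?_⟩
  intro Ω _ μ _ γ Y₀ Z σ hγ hγ2 hγs _ hZ
  exact hZ.ae_tendsto_mxl hsmooth hD hnash hγ hγ2 hγs
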